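/- Let $\mathbb N_2$ be the set of unordered pairs of distinct natural numbers and let $\mu$ be a probability measure on $\mathbb N_2$. Write $\mu_e=\mu(\{e\})$, $\mu_{ij}=\mu_{\{i,j\}}$, $M_i=\sum_{j\ne i}\mu_{ij}$, and $M_e=M_i+M_j-\mu_{ij}$ for $e=\{i,j\}$. The support of $\mu$ is the graph whose edges are the $e\in\mathbb N_2$ with $\mu_e>0$ and whose vertices are the endpoints of these edges; $\mu$ has connected support if this graph is connected. Discrete time: let $e_1,e_2,\dots$ be independent with law $\mu$, and for $n\ge 0$ let $G_n$ be the graph with edge set $\{e_1,\dots,e_n\}$ whose vertices are the endpoints of these edges. Continuous time: let $(N_e(t))_{t\ge0}$, $e\in\mathbb N_2$, be independent Poisson processes with intensities $\mu_e$, and for $t\ge 0$ let $G_t$ be the graph with edge set $\{e: N_e(t)\ge 1\}$ whose vertices are the endpoints of these edges. (Parallel edges are identified.) A graph-valued process $(X_i)_{i\in I}$ with $I=\mathbb N$ or $I=[0,\infty)$ is eventually forever connected at an outcome $\omega$ if there is $i=i(\omega)\in I$ such that $X_j(\omega)$ is connected for all $j\in I$ with $j>i$. Theorem. If $\mu$ has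 connected support and $$\sum_{e\in\mathbb N_2}\frac{\mu_e}{M_e}<\infty$$ (terms with $\mu_e=0$ are read as $0$), then almost surely $(G_t)_{t\ge0}$ is eventually forever connected, and almost surely $(G_n)_{n\ge0}$ is eventually forever connected. Otherwise, that is, if $\mu$ does not have connected support or the sum is infinite, then almost surely $(G_t)_{t\ge0}$ is not eventually forever connected, and almost surely $(G_n)_{n\ge0}$ is not eventually forever connected. -/

import Mathlib

open MeasureTheory ProbabilityTheory
open scoped NNReal ENNReal

namespace EdgeExchangeable

/-- The set `ℕ₂` of unordered pairs of distinct natural numbers (the possible edges). -/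
abbrev Edge : Type := {e : Sym2 ℕ // ¬ e.IsDiag}

/-- Every set of edges is measurable. -/
instance : DiscreteMeasurableSpace Edge := by
  refine ⟨fun s => ?_⟩
  refine ⟨Subtype.val '' s, ?_, Set.preimage_image_eq s Subtype.val_injective⟩
  exact (MeasurableSet.of_discrete : MeasurableSet (Sym2.mk.uncurry ⁻¹' (Subtype.val '' s)))

/-- The simple graph with edge set `S` and the minimal vertex set containing the endpoints of the
edges in `S` (so there are no isolated vertices), as a subgraph of the complete graph on `ℕ`. -/
def edgeGraph (S : Set Edge) : (⊤ : SimpleGraph ℕ).Subgraph where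
  verts := {v | ∃ e ∈ S, v ∈ (e : Sym2 ℕ)}
  Adj u v := ∃ e ∈ S, (e : Sym2 ℕ) = s(u, v)
  adj_sub := by
    rintro u v ⟨e, -, he⟩ rfl
    exact e.2 (by rw [he]; exact Sym2.mk_isDiag_iff.2 rfl)
  edge_vert := by
    rintro u v ⟨e, heS, he⟩
    exact ⟨e, heS, by rw [he]; exact Sym2.mem_mk_left u v⟩
  symm := ⟨fun u v ⟨e, heS, he⟩ => ⟨e, heS, by rw [he, Sym2.eq_swap]⟩⟩

/-- The support of `μ`: the graph formed by the edges of positive mass and their endpoints. -/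
def supportGraph (μ : Measure Edge) : (⊤ : SimpleGraph ℕ).Subgraph :=
  edgeGraph {e | 0 < μ {e}}

/-- `μ_{ij}`, the mass of the edge `{i, j}` (it is `0` for `i = j`, which is not an edge). -/
noncomputable def pairMass (μ : Measure Edge) (i j : ℕ) : ℝ≥0∞ :=
  μ {e | (e : Sym2 ℕ) = s(i, j)}

/-- `M_i = ∑_j μ_{ij}`. -/
noncomputable def vertexMass (μ : Measure Edge) (i : ℕ) : ℝ≥0∞ :=
  ∑' j, pairMass μ i j

/-- `M_e = M_i + M_j - μ_{ij}` for `e = {i, j}`. The subtraction is never truncated, since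
`μ_{ij} ≤ M_i`. -/
noncomputable def edgeMass (μ : Measure Edge) (e : Edge) : ℝ≥0∞ :=
  Sym2.lift ⟨fun i j => vertexMass μ i + vertexMass μ j - pairMass μ i j, fun i j => by
    simp only [pairMass, add_comm (vertexMass μ i), Sym2.eq_swap (a := i) (b := j)]⟩ (e : Sym2 ℕ)

/-- The process `X`, indexed by `I`, satisfies the property `A` at all sufficiently late times. -/
def EventuallyForever {I α : Type*} [LT I] (A : α → Prop) (X : I → α) : Prop :=
  ∃ i, ∀ j, i < j → A (X j)

/-- The discrete-time graph after `n` steps, parallel edges being identified: start from the empty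
graph and take the union with one sampled edge at a time; `ξ n` is the `(n+1)`-st sampled edge. -/
def discreteGraph (ξ : ℕ → Edge) : ℕ → (⊤ : SimpleGraph ℕ).Subgraph
  | 0 => ⊥
  | n + 1 => discreteGraph ξ n ⊔ edgeGraph {ξ n}

/-- The continuous-time graph at time `t`, parallel edges being identified: `N e t` is the number
of copies of the edge `e` present at time `t`. -/
def continuousGraph (N : Edge → ℝ≥0 → ℕ) (t : ℝ≥0) : (⊤ : SimpleGraph ℕ).Subgraph :=
  edgeGraph {e | 0 < N e t}

/-- `X` is a (homogeneous) Poisson process of intensity `r`: almost surely `X` starts at `0` and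
has nondecreasing right-continuous paths, and its increments are independent and Poisson
distributed with mean `r` times the length of the time interval. -/
structure IsPoissonProcess {Ω : Type*} [MeasurableSpace Ω] (X : ℝ≥0 → Ω → ℕ) (r : ℝ≥0)
    (P : Measure Ω) : Prop where
  measurable : ∀ t, Measurable (X t)
  start : ∀ᵐ ω ∂P, X 0 ω = 0
  path_monotone : ∀ᵐ ω ∂P, Monotone fun t => X t ω
  path_rightContinuous : ∀ᵐ ω ∂P, ∀ t, ContinuousWithinAt (fun s => X s ω) (Set.Ici t) t
  indepIncrements : HasIndepIncrements X P
  increment_law : ∀ s t, s ≤ t →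
    HasLaw (fun ω => X t ω - X s ω) (poissonMeasure (r * (t - s))) P

/-- The edges `ξ 0, ξ 1, …` are independent samples from `μ`. -/
structure IsIIDSample {Ω : Type*} [MeasurableSpace Ω] (ξ : ℕ → Ω → Edge) (μ : Measure Edge)
    (P : Measure Ω) : Prop where
  measurable : ∀ n, Measurable (ξ n)
  law : ∀ n, HasLaw (ξ n) μ P
  indep : iIndepFun ξ P

/-- The counting processes `N e` of the edges `e` are independent Poisson processes with
intensities `μ_e = μ {e}`. -/
structure IsPoissonEdgeProcess {Ω : Type*} [MeasurableSpace Ω] (N : Edge → ℝ≥0 → Ω → ℕ)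
    (μ : Measure Edge) (P : Measure Ω) : Prop where
  poisson : ∀ e, IsPoissonProcess (N e) (μ {e}).toNNReal P
  indep : iIndepFun (fun e ω t => N e t ω) P

end EdgeExchangeable

open EdgeExchangeable

/-! Call an edge `e` a seed if it appears before every other edge touching it. Since `M_e` is the
mass of the set `star e` of edges touching `e`, the seed probability is `μ_e / M_e` in both models,
so the sum in the theorem is the expected number of seeds.

Tracing any present edge back through ever earlier touching edges ends at a seed, so every component
always contains one. If the sum is finite, Borel–Cantelli leaves finitely many seeds; in a connected
support these are joined by finitely many finite paths, all eventually present, and from then on the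
graph is connected (`eventuallyForever_connected`).

Conversely, a seed is an isolated edge when it appears. Only finitely many edges are present at any
time, so infinitely many seeds disconnect the graph at arbitrarily late times. If the sum is
infinite, there are almost surely infinitely many seeds by a second-moment argument: distinct
touching edges are never both seeds, and for the others the excess of the joint probability over the
product is governed by the mass of `star e ∩ star f`. These excesses add up to at most twice the
mean (`tsum_seedWeight_mul_inter_le`), so the variance is at most a constant times the mean. If the
support is disconnected, no path in it ever joins two of its components.

Both models yield the same seed probability and the same pair bound, by geometric series in discrete
time and by races of exponential clocks in continuous time. -/

namespace EdgeExchangeable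

/-! ### Touching edges and paths in a set of edges -/

/-- Two edges touch if they share an endpoint; in particular every edge touches itself. -/
def Touch (e f : Edge) : Prop := ∃ v, v ∈ (e : Sym2 ℕ) ∧ v ∈ (f : Sym2 ℕ)

/-- The set of all edges that touch `e`, including `e`. -/
def star (e : Edge) : Set Edge := {f | Touch e f}

lemma Touch.symm {e f : Edge} (h : Touch e f) : Touch f e :=
  h.imp fun _ hv => hv.symm

lemma touch_self (e : Edge) : Touch e e := ⟨_, Sym2.out_fst_mem _, Sym2.out_fst_mem _⟩

/-- `u` and `v` are joined by a path whose edges belong to `S`. -/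
def Joined (S : Set Edge) : ℕ → ℕ → Prop := Relation.ReflTransGen (edgeGraph S).Adj

lemma Joined.symm {S : Set Edge} {u v : ℕ} (h : Joined S u v) : Joined S v u :=
  haveI := (edgeGraph S).symm
  Relation.ReflTransGen.stdSymm.symm _ _ h

lemma Joined.trans {S : Set Edge} {u v w : ℕ} (h : Joined S u v) (h' : Joined S v w) :
    Joined S u w :=
  Relation.ReflTransGen.trans h h'

lemma Joined.mono {S S' : Set Edge} (hS : S ⊆ S') {u v : ℕ} (h : Joined S u v) : Joined S' u v :=
  Relation.ReflTransGen.mono (fun _ _ ⟨e, he, h⟩ => ⟨e, hS he, h⟩) _ _ h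

lemma joined_of_mem {S : Set Edge} {e : Edge} (he : e ∈ S) {u v : ℕ} (hu : u ∈ (e : Sym2 ℕ))
    (hv : v ∈ (e : Sym2 ℕ)) : Joined S u v := by
  by_cases huv : u = v
  · subst huv; exact Relation.ReflTransGen.refl
  · exact Relation.ReflTransGen.single ⟨e, he, (Sym2.mem_and_mem_iff huv).1 ⟨hu, hv⟩⟩

lemma edgeGraph_connected_iff {S : Set Edge} :
    (edgeGraph S).Connected ↔ S.Nonempty ∧
      ∀ u ∈ (edgeGraph S).verts, ∀ v ∈ (edgeGraph S).verts, Joined S u v := by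
  rw [SimpleGraph.Subgraph.connected_iff']
  constructor
  · intro h
    obtain ⟨⟨w, e, he, -⟩⟩ := h.nonempty
    refine ⟨⟨e, he⟩, fun u hu v hv => ?_⟩
    have := (SimpleGraph.reachable_iff_reflTransGen _ _).1 (h.preconnected ⟨u, hu⟩ ⟨v, hv⟩)
    exact Relation.ReflTransGen.lift (p := (edgeGraph S).Adj) Subtype.val
      (fun a b (hab : (edgeGraph S).coe.Adj a b) => hab) _ _ this
  · rintro ⟨⟨e, he⟩, h⟩
    have : Nonempty (edgeGraph S).verts := ⟨⟨_, e, he, Sym2.out_fst_mem _⟩⟩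
    refine ⟨fun ⟨u, hu⟩ ⟨v, hv⟩ => ?_⟩
    rw [SimpleGraph.reachable_iff_reflTransGen]
    -- A path in `ℕ` lifts to the subgraph because each vertex it leaves is an endpoint of an edge
    -- in `S`.
    suffices H : ∀ w, Joined S u w → ∀ hw : w ∈ (edgeGraph S).verts,
        Relation.ReflTransGen (edgeGraph S).coe.Adj ⟨u, hu⟩ ⟨w, hw⟩ from H v (h u hu v hv) hv
    intro w hw
    induction hw with
    | refl => intro _; exact Relation.ReflTransGen.refl
    | tail _ hbc ih => intro hc; exact (ih ((edgeGraph S).edge_vert hbc)).tail hbc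

/-- In a finite set of edges, if every edge outside `R` touches an edge of smaller rank, then every
edge is joined to an edge in `R`. -/
lemma exists_joined_of_rank {ι : Type*} [Preorder ι] (T : Edge → ι) {S R : Set Edge}
    (hS : S.Finite) (h : ∀ e ∈ S, e ∈ R ∨ ∃ f ∈ S, Touch e f ∧ T f < T e) :
    ∀ e ∈ S, ∀ u ∈ (e : Sym2 ℕ), ∃ r ∈ S ∩ R, ∃ v ∈ (r : Sym2 ℕ), Joined S u v := by
  have wf : S.WellFoundedOn (fun a b => T a < T b) := by
    have : IsStrictOrder Edge (fun a b => T a < T b) :=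
      { irrefl := fun a => lt_irrefl _, trans := fun a b c => lt_trans }
    exact hS.wellFoundedOn
  intro e he
  refine wf.induction (P := fun e => ∀ u ∈ (e : Sym2 ℕ), ∃ r ∈ S ∩ R, ∃ v ∈ (r : Sym2 ℕ),
    Joined S u v) he fun e he ih u hu => ?_
  rcases h e he with hR | ⟨f, hf, ⟨w, hwe, hwf⟩, hlt⟩
  · exact ⟨e, ⟨he, hR⟩, u, hu, Relation.ReflTransGen.refl⟩
  · obtain ⟨r, hr, v, hv, hj⟩ := ih f hf hlt w hwf
    exact ⟨r, hr, v, hv, (joined_of_mem he hu hwe).trans hj⟩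

/-! ### Deterministic criteria for growing edge sets -/

/-- The process `E` of edge sets reaches a stage at which `e` is present and touches no other
edge. -/
def IsSeed {I : Type*} (E : I → Set Edge) (e : Edge) : Prop :=
  ∃ j, e ∈ E j ∧ ∀ f ∈ E j, f ≠ e → ¬ Touch e f

/-- A path starting at an endpoint of `e` can only use `e`, so it never reaches `g`. The second edge
`g` is needed: a single edge is a connected graph. -/
lemma not_connected_of_isolated {S : Set Edge} {e g : Edge} (he : e ∈ S) (hg : g ∈ S)
    (hge : g ≠ e) (h : ∀ f ∈ S, f ≠ e → ¬ Touch e f) : ¬ (edgeGraph S).Connected := by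
  rw [edgeGraph_connected_iff]
  rintro ⟨-, hc⟩
  have key : ∀ u v, Joined S u v → u ∈ (e : Sym2 ℕ) → v ∈ (e : Sym2 ℕ) := by
    intro u v huv hu
    induction huv with
    | refl => exact hu
    | @tail b c _ hbc ih =>
      obtain ⟨f, hf, hfe⟩ := hbc
      by_cases hfe' : f = e
      · rw [← hfe', hfe]; exact Sym2.mem_mk_right _ _
      · exact absurd ⟨b, ih, by rw [hfe]; exact Sym2.mem_mk_left _ _⟩ (h f hf hfe')
  refine h g hg hge ⟨(g : Sym2 ℕ).out.1, ?_, Sym2.out_fst_mem _⟩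
  exact key _ _ (hc _ ⟨e, he, Sym2.out_fst_mem _⟩ _ ⟨g, hg, Sym2.out_fst_mem _⟩)
    (Sym2.out_fst_mem _)

section

variable {I : Type*} [LinearOrder I]

lemma not_eventuallyForever_of_infinite_seeds {E : I → Set Edge} (hE : Monotone E)
    (hfin : ∀ i, (E i).Finite) (hseed : {e | IsSeed E e}.Infinite) :
    ¬ EventuallyForever SimpleGraph.Subgraph.Connected (fun i => edgeGraph (E i)) := by
  rintro ⟨i, hi⟩
  obtain ⟨g, j₀, hg, -⟩ := hseed.nonempty
  -- A seed absent at stage `max i j₀` must be isolated at a later stage, when `g` is already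
  -- present.
  obtain ⟨e, ⟨j, hej, hj⟩, he⟩ := (hseed.sdiff (hfin (max i j₀))).nonempty
  have hlt : max i j₀ < j := by
    by_contra hle
    exact he (hE (not_lt.1 hle) hej)
  have hg' : g ∈ E (max i j₀) := hE (le_max_right _ _) hg
  refine not_connected_of_isolated hej (hE hlt.le hg') ?_ hj (hi j ((le_max_left _ _).trans_lt hlt))
  rintro rfl
  exact he hg'

lemma eventually_joined [Nonempty I] {E : I → Set Edge} (hE : Monotone E) {W : Set Edge}
    (hW : ∀ e ∈ W, ∃ i, e ∈ E i) {u v : ℕ} (h : Joined W u v) :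
    ∀ᶠ i in Filter.atTop, Joined (E i) u v := by
  induction h with
  | refl => exact Filter.Eventually.of_forall fun _ => Relation.ReflTransGen.refl
  | tail _ hbc ih =>
    obtain ⟨e, he, hbc⟩ := hbc
    obtain ⟨i, hi⟩ := hW e he
    filter_upwards [ih, Filter.eventually_ge_atTop i] with j hj hij
    exact Relation.ReflTransGen.tail hj ⟨e, hE hij hi, hbc⟩

/-- Every vertex present is joined to a root in `R`. As `R` is finite, the paths in `W` between its
members are all present from some stage on. -/
lemma eventuallyForever_connected [Nonempty I] {E : I → Set Edge} (hE : Monotone E) {W : Set Edge}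
    (hW : ∀ e, e ∈ W ↔ ∃ i, e ∈ E i) (hconn : (edgeGraph W).Connected) {R : Set Edge}
    (hR : R.Finite)
    (hroot : ∀ i, ∀ e ∈ E i, ∀ u ∈ (e : Sym2 ℕ),
      ∃ r ∈ E i ∩ R, ∃ v ∈ (r : Sym2 ℕ), Joined (E i) u v) :
    EventuallyForever SimpleGraph.Subgraph.Connected (fun i => edgeGraph (E i)) := by
  obtain ⟨⟨e₀, he₀⟩, hc⟩ := edgeGraph_connected_iff.1 hconn
  obtain ⟨i₀, hi₀⟩ := (hW e₀).1 he₀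
  have hpair : ∀ᶠ i in Filter.atTop, ∀ r ∈ R ∩ W, ∀ s ∈ R ∩ W,
      Joined (E i) (r : Sym2 ℕ).out.1 (s : Sym2 ℕ).out.1 := by
    rw [Filter.eventually_all_finite (hR.inter_of_left W)]
    intro r hr
    rw [Filter.eventually_all_finite (hR.inter_of_left W)]
    intro s hs
    exact eventually_joined hE (fun e he => (hW e).1 he)
      (hc _ ⟨r, hr.2, Sym2.out_fst_mem _⟩ _ ⟨s, hs.2, Sym2.out_fst_mem _⟩)
  obtain ⟨i, hi⟩ := Filter.eventually_atTop.1
    (hpair.and (Filter.eventually_ge_atTop i₀))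
  refine ⟨i, fun j hj => edgeGraph_connected_iff.2 ⟨⟨e₀, hE (hi j hj.le).2 hi₀⟩, ?_⟩⟩
  rintro u ⟨e, he, hu⟩ v ⟨f, hf, hv⟩
  obtain ⟨r, ⟨hrE, hrR⟩, x, hx, hux⟩ := hroot j e he u hu
  obtain ⟨s, ⟨hsE, hsR⟩, y, hy, hvy⟩ := hroot j f hf v hv
  refine hux.trans (((joined_of_mem hrE hx (Sym2.out_fst_mem _)).trans ?_).trans hvy.symm)
  exact ((hi j hj.le).1 r ⟨hrR, (hW r).2 ⟨j, hrE⟩⟩ s ⟨hsR, (hW s).2 ⟨j, hsE⟩⟩).trans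
    (joined_of_mem hsE (Sym2.out_fst_mem _) hy)

lemma not_eventuallyForever_of_not_connected [Nonempty I] [NoMaxOrder I] {E : I → Set Edge}
    (hE : Monotone E) {W : Set Edge} (hW : ∀ e, e ∈ W ↔ ∃ i, e ∈ E i) (hne : W.Nonempty)
    (hconn : ¬ (edgeGraph W).Connected) :
    ¬ EventuallyForever SimpleGraph.Subgraph.Connected (fun i => edgeGraph (E i)) := by
  rintro ⟨i, hi⟩
  rw [edgeGraph_connected_iff] at hconn
  push Not at hconn
  obtain ⟨u, ⟨e, he, hu⟩, v, ⟨f, hf, hv⟩, huv⟩ := hconn hne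
  obtain ⟨a, ha⟩ := (hW e).1 he
  obtain ⟨b, hb⟩ := (hW f).1 hf
  obtain ⟨j, hj⟩ := exists_gt (max i (max a b))
  have hj' := max_lt_iff.1 hj
  have hj'' := max_lt_iff.1 hj'.2
  refine huv (((edgeGraph_connected_iff.1 (hi j hj'.1)).2 u ⟨e, hE hj''.1.le ha, hu⟩
    v ⟨f, hE hj''.2.le hb, hv⟩).mono fun g hg => (hW g).2 ⟨j, hg⟩)

end

/-! ### Seed weights and the second-moment method -/

section

lemma vertexMass_eq (μ : Measure Edge) (i : ℕ) :
    vertexMass μ i = μ {f : Edge | i ∈ (f : Sym2 ℕ)} := by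
  have : {f : Edge | i ∈ (f : Sym2 ℕ)} = ⋃ j, {f : Edge | (f : Sym2 ℕ) = s(i, j)} := by
    ext f; simp [Sym2.mem_iff_exists]
  rw [this, measure_iUnion]
  · rfl
  · intro j k hjk
    refine Set.disjoint_left.2 fun f hf hf' => hjk ?_
    exact Sym2.congr_right.1 ((hf : (f : Sym2 ℕ) = _).symm.trans hf')
  · exact fun _ => MeasurableSet.of_discrete

/-- Inclusion–exclusion: only `{i, j}` itself contains both `i` and `j`. -/
lemma edgeMass_eq (μ : Measure Edge) [IsFiniteMeasure μ] (e : Edge) :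
    edgeMass μ e = μ (star e) := by
  obtain ⟨e, he⟩ := e
  induction e with
  | _ i j =>
  have hij : i ≠ j := fun h => he (Sym2.mk_isDiag_iff.2 h)
  have h1 : star ⟨s(i, j), he⟩ = {f : Edge | i ∈ (f : Sym2 ℕ)} ∪ {f : Edge | j ∈ (f : Sym2 ℕ)} := by
    ext f; simp [star, Touch]
  have h2 : {f : Edge | (f : Sym2 ℕ) = s(i, j)} =
      {f : Edge | i ∈ (f : Sym2 ℕ)} ∩ {f : Edge | j ∈ (f : Sym2 ℕ)} := by
    ext f; exact (Sym2.mem_and_mem_iff hij).symm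
  have h3 := measure_union_add_inter (μ := μ) {f : Edge | i ∈ (f : Sym2 ℕ)}
    (MeasurableSet.of_discrete (s := {f : Edge | j ∈ (f : Sym2 ℕ)}))
  change vertexMass μ i + vertexMass μ j - pairMass μ i j = _
  rw [vertexMass_eq, vertexMass_eq, pairMass, h1, h2, ← h3,
    ENNReal.add_sub_cancel_right (measure_ne_top _ _)]

/-- The probability that `e` appears before all other edges touching it. -/
noncomputable def seedWeight (μ : Measure Edge) (e : Edge) : ℝ≥0∞ := μ {e} / μ (star e)

variable {μ : Measure Edge}

lemma mass_le_star (e : Edge) : μ {e} ≤ μ (star e) :=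
  measure_mono (Set.singleton_subset_iff.2 (touch_self e))

lemma seedWeight_eq_zero {e : Edge} (he : μ {e} = 0) : seedWeight μ e = 0 := by
  simp [seedWeight, he]

/-- The star of an edge at `i` contains all edges at `i`, so its weight is at most its share of
`M_i`. -/
lemma tsum_seedWeight_vertex_le (i : ℕ) :
    ∑' f : Edge, Set.indicator {f : Edge | i ∈ (f : Sym2 ℕ)} (seedWeight μ) f ≤ 1 := by
  calc _ ≤ ∑' f : Edge, Set.indicator {f : Edge | i ∈ (f : Sym2 ℕ)}
          (fun f => μ {f}) f / μ {f : Edge | i ∈ (f : Sym2 ℕ)} := by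
        refine ENNReal.tsum_le_tsum fun f => ?_
        by_cases hf : i ∈ (f : Sym2 ℕ)
        · simp only [Set.indicator, Set.mem_ofPred_eq, hf, if_true, seedWeight]
          have hsub : {g : Edge | i ∈ (g : Sym2 ℕ)} ⊆ star f := by
            intro g hg
            exact Exists.intro i ⟨hf, hg⟩
          exact ENNReal.div_le_div_left (measure_mono hsub) _
        · simp [Set.indicator, hf]
    _ = μ {f : Edge | i ∈ (f : Sym2 ℕ)} / μ {f : Edge | i ∈ (f : Sym2 ℕ)} := by
        simp only [div_eq_mul_inv]
        rw [ENNReal.tsum_mul_right, ← Measure.tsum_indicator_apply_singleton μ _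
          MeasurableSet.of_discrete]
    _ ≤ 1 := ENNReal.div_self_le_one

lemma tsum_seedWeight_star_le (e : Edge) :
    ∑' f : Edge, Set.indicator (star e) (seedWeight μ) f ≤ 2 := by
  obtain ⟨e, he⟩ := e
  induction e with
  | _ i j =>
  calc _ ≤ ∑' f : Edge, (Set.indicator {f : Edge | i ∈ (f : Sym2 ℕ)} (seedWeight μ) f +
          Set.indicator {f : Edge | j ∈ (f : Sym2 ℕ)} (seedWeight μ) f) := by
        refine ENNReal.tsum_le_tsum fun f => Set.indicator_apply_le' (fun h => ?_) (fun _ => zero_le)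
        obtain ⟨v, hv, hvf⟩ : Touch _ f := h
        rcases Sym2.mem_iff.1 hv with rfl | rfl
        · simp [Set.indicator, hvf]
        · simp [Set.indicator, hvf]
    _ ≤ 1 + 1 := by
        rw [ENNReal.tsum_add]
        exact add_le_add (tsum_seedWeight_vertex_le i) (tsum_seedWeight_vertex_le j)
    _ = 2 := one_add_one_eq_two

/-- Expand the mass of the intersection over its edges `g` and exchange the sums: each `g` in `star
e` is counted with the total weight of the edges touching it, which is at most `2`. -/
lemma tsum_seedWeight_mul_inter_le (e : Edge) :
    ∑' f : Edge, seedWeight μ f * μ (star e ∩ star f) ≤ 2 * μ (star e) := by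
  have h (A : Set Edge) : μ A = ∑' g, A.indicator (fun g => μ {g}) g :=
    (Measure.tsum_indicator_apply_singleton μ _ MeasurableSet.of_discrete).symm
  calc _ = ∑' f : Edge, ∑' g : Edge,
          (star e).indicator (fun g => μ {g}) g * (star g).indicator (seedWeight μ) f := by
        refine tsum_congr fun f => ?_
        rw [h, ← ENNReal.tsum_mul_left]
        refine tsum_congr fun g => ?_
        by_cases h1 : g ∈ star e <;> by_cases h2 : Touch f g
        · have h3 : g ∈ star f := h2
          have h4 : f ∈ star g := h2.symm
          rw [Set.indicator_of_mem (Set.mem_inter h1 h3), Set.indicator_of_mem h1,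
            Set.indicator_of_mem h4, mul_comm]
        · have h3 : g ∉ star e ∩ star f := fun h => h2 h.2
          have h4 : f ∉ star g := fun h => h2 (Touch.symm h)
          rw [Set.indicator_of_notMem h3, Set.indicator_of_notMem h4, mul_zero, mul_zero]
        all_goals
          have h3 : g ∉ star e ∩ star f := fun h => h1 h.1
          rw [Set.indicator_of_notMem h3, Set.indicator_of_notMem h1, mul_zero, zero_mul]
    _ = ∑' g : Edge, (star e).indicator (fun g => μ {g}) g *
          ∑' f : Edge, (star g).indicator (seedWeight μ) f := by
        rw [ENNReal.tsum_comm]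
        simp_rw [ENNReal.tsum_mul_left]
    _ ≤ ∑' g : Edge, (star e).indicator (fun g => μ {g}) g * 2 := by
        gcongr; exact tsum_seedWeight_star_le _
    _ = _ := by rw [ENNReal.tsum_mul_right, ← h, mul_comm]

/-- Here `A`, `B`, `U`, `D` stand for the masses of two stars, their union and their intersection.
The left side is `ab(A + B)/(UAB) = ab(1 + D/U)/(AB)`, and `D/U ≤ D/A`. -/
lemma ennreal_pair_le {a b A B U D : ℝ≥0∞} (hA : A ≠ 0) (hB : B ≠ 0) (hU : U ≠ ∞) (hAU : A ≤ U)
    (hBU : B ≤ U) (h : A + B = U + D) :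
    a / U * (b / B) + b / U * (a / A) ≤ a / A * (b / B) + a / A / A * (b / B * D) := by
  have hA' : A ≠ ∞ := ne_top_of_le_ne_top hU hAU
  have hB' : B ≠ ∞ := ne_top_of_le_ne_top hU hBU
  have hU0 : U ≠ 0 := fun h0 => hA (le_antisymm (h0 ▸ hAU) zero_le)
  calc a / U * (b / B) + b / U * (a / A)
      = a * b * (U⁻¹ * B⁻¹) + a * b * (U⁻¹ * A⁻¹) := by simp only [div_eq_mul_inv]; ring
    _ = a * b * (U⁻¹ * B⁻¹) * (A⁻¹ * A) + a * b * (U⁻¹ * A⁻¹) * (B⁻¹ * B) := by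
        rw [ENNReal.inv_mul_cancel hA hA', ENNReal.inv_mul_cancel hB hB', mul_one, mul_one]
    _ = a * b * (U⁻¹ * B⁻¹ * A⁻¹) * (A + B) := by ring
    _ = a * b * (B⁻¹ * A⁻¹) * (U⁻¹ * U) + a * b * (B⁻¹ * A⁻¹) * (U⁻¹ * D) := by rw [h]; ring
    _ ≤ a * b * (B⁻¹ * A⁻¹) * 1 + a * b * (B⁻¹ * A⁻¹) * (A⁻¹ * D) := by
        rw [ENNReal.inv_mul_cancel hU0 hU]
        gcongr
    _ = _ := by simp only [div_eq_mul_inv]; ring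

/-- The pair bound makes the variance of a finite partial count at most `C` times its mean `m`, so
by Chebyshev the count stays below `m / 2` with probability at most `4C / m`. -/
lemma ae_infinite_of_second_moment {Ω ι : Type*} [MeasurableSpace Ω] {P : Measure Ω}
    [IsProbabilityMeasure P] {S : ι → Set Ω} (hS : ∀ i, MeasurableSet (S i)) (C : ℝ≥0)
    (hsum : ∑' i, P (S i) = ∞)
    (hpair : ∀ F : Finset ι, ∑ i ∈ F, ∑ j ∈ F, P (S i ∩ S j) ≤
      (∑ i ∈ F, P (S i)) ^ 2 + C * ∑ i ∈ F, P (S i)) :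
    ∀ᵐ ω ∂P, {i | ω ∈ S i}.Infinite := by
  have cheb (F : Finset ι) (K : ℕ) (hF : 2 * (K + 1) ≤ ∑ i ∈ F, P.real (S i)) :
      P {ω | ∑ i ∈ F, (S i).indicator (1 : Ω → ℝ) ω ≤ K} ≤
        ENNReal.ofReal (4 * C / ∑ i ∈ F, P.real (S i)) := by
    set X : Ω → ℝ := fun ω => ∑ i ∈ F, (S i).indicator (1 : Ω → ℝ) ω with hX
    set m := ∑ i ∈ F, P.real (S i) with hm
    have hmpos : 0 < m := lt_of_lt_of_le (by positivity) hF
    have hbdd : MemLp X 2 P := by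
      refine memLp_finsetSum _ fun i _ => ?_
      exact (memLp_const (1 : ℝ)).indicator (hS i)
    have hmean : ∫ ω, X ω ∂P = m := by
      rw [hX, integral_finsetSum]
      · refine Finset.sum_congr rfl fun i _ => integral_indicator_one (hS i)
      · exact fun i _ => (integrable_const (1 : ℝ)).indicator (hS i)
    have hsq : ∫ ω, X ω ^ 2 ∂P = ∑ i ∈ F, ∑ j ∈ F, P.real (S i ∩ S j) := by
      have : ∀ ω, X ω ^ 2 = ∑ i ∈ F, ∑ j ∈ F, (S i ∩ S j).indicator (1 : Ω → ℝ) ω := by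
        intro ω
        rw [hX, sq, Finset.sum_mul_sum]
        refine Finset.sum_congr rfl fun i _ => Finset.sum_congr rfl fun j _ => ?_
        rw [Set.inter_indicator_one]; rfl
      simp_rw [this]
      rw [integral_finsetSum]
      · refine Finset.sum_congr rfl fun i _ => ?_
        rw [integral_finsetSum]
        · exact Finset.sum_congr rfl fun j _ => integral_indicator_one ((hS i).inter (hS j))
        · exact fun j _ => (integrable_const (1 : ℝ)).indicator ((hS i).inter (hS j))
      · exact fun i _ => integrable_finsetSum _ fun j _ =>
          (integrable_const (1 : ℝ)).indicator ((hS i).inter (hS j))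
    have hpair' : ∑ i ∈ F, ∑ j ∈ F, P.real (S i ∩ S j) ≤ m ^ 2 + C * m := by
      have hfin : ∑ i ∈ F, P (S i) ≠ ∞ := ENNReal.sum_ne_top.2 fun i _ => measure_ne_top _ _
      have h1 := ENNReal.toReal_mono (by finiteness) (hpair F)
      rw [ENNReal.toReal_add (by finiteness) (by finiteness), ENNReal.toReal_pow,
        ENNReal.toReal_mul, ENNReal.toReal_sum (fun i _ => measure_ne_top _ _),
        ENNReal.toReal_sum (fun i _ => ENNReal.sum_ne_top.2 fun j _ => measure_ne_top _ _)] at h1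
      simp_rw [ENNReal.toReal_sum (fun j _ => measure_ne_top P _)] at h1
      exact h1
    have hvar : Var[X; P] ≤ C * m := by
      rw [variance_eq_sub hbdd]
      simp only [Pi.pow_apply]
      rw [hsq, hmean]
      linarith
    calc P {ω | X ω ≤ K} ≤ P {ω | m / 2 ≤ |X ω - ∫ ω, X ω ∂P|} := by
          refine measure_mono fun ω hω => ?_
          have hω : X ω ≤ K := hω
          rw [Set.mem_ofPred_eq, hmean, abs_sub_comm]
          exact le_trans (by linarith) (le_abs_self _)
      _ ≤ ENNReal.ofReal (Var[X; P] / (m / 2) ^ 2) :=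
          meas_ge_le_variance_div_sq hbdd (by positivity)
      _ ≤ ENNReal.ofReal (4 * C / m) := by
          refine ENNReal.ofReal_le_ofReal ?_
          rw [div_le_div_iff₀ (by positivity) hmpos]
          nlinarith [mul_le_mul_of_nonneg_right hvar hmpos.le]
  have hlarge (x : ℝ≥0) : ∃ F : Finset ι, (x : ℝ) < ∑ i ∈ F, P.real (S i) := by
    have : (x : ℝ≥0∞) < ∑' i, P (S i) := by rw [hsum]; exact ENNReal.coe_lt_top
    rw [ENNReal.tsum_eq_iSup_sum, lt_iSup_iff] at this
    obtain ⟨F, hF⟩ := this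
    refine ⟨F, ?_⟩
    have hfin : ∑ i ∈ F, P (S i) ≠ ∞ := ENNReal.sum_ne_top.2 fun i _ => measure_ne_top _ _
    have := (ENNReal.toReal_lt_toReal ENNReal.coe_ne_top hfin).2 hF
    rwa [ENNReal.toReal_sum (fun i _ => measure_ne_top _ _)] at this
  -- Finiteness is part of the event because `ncard` is `0` on infinite sets.
  have hnull (K : ℕ) : P {ω | {i | ω ∈ S i}.Finite ∧ {i | ω ∈ S i}.ncard ≤ K} = 0 := by
    refine le_antisymm (ENNReal.le_of_forall_pos_le_add fun ε hε _ => ?_) zero_le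
    rw [zero_add]
    obtain ⟨F, hF⟩ := hlarge (max (2 * (K + 1)) (4 * C / ε))
    rw [NNReal.coe_max, max_lt_iff] at hF
    push_cast at hF
    have hm : 0 < ∑ i ∈ F, P.real (S i) := lt_of_le_of_lt (by positivity) hF.1
    have hε' : (0 : ℝ) < ε := hε
    calc _ ≤ P {ω | ∑ i ∈ F, (S i).indicator (1 : Ω → ℝ) ω ≤ K} := by
          refine measure_mono fun ω ⟨hfin, hK⟩ => ?_
          classical
          have : ∑ i ∈ F, (S i).indicator (1 : Ω → ℝ) ω = (F.filter fun i => ω ∈ S i).card := by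
            simp [Set.indicator, Finset.sum_boole]
          rw [Set.mem_ofPred_eq, this]
          refine Nat.cast_le.2 (le_trans ?_ hK)
          rw [← Set.ncard_coe_finset]
          exact Set.ncard_le_ncard (fun i hi => (Finset.mem_filter.1 hi).2) hfin
      _ ≤ _ := cheb F K hF.1.le
      _ ≤ ENNReal.ofReal ε := by
          refine ENNReal.ofReal_le_ofReal ?_
          have := hF.2.le
          rw [div_le_iff₀ hε'] at this
          rw [div_le_iff₀ hm]
          linarith
      _ = ε := ENNReal.ofReal_coe_nnreal
  have hall : ∀ᵐ ω ∂P, ∀ K : ℕ, ¬ ({i | ω ∈ S i}.Finite ∧ {i | ω ∈ S i}.ncard ≤ K) := by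
    rw [ae_all_iff]
    intro K
    rw [ae_iff]
    simpa using hnull K
  filter_upwards [hall] with ω hω hfin
  exact hω _ ⟨hfin, le_rfl⟩

lemma ae_finite_seeds {Ω : Type*} [MeasurableSpace Ω] {P : Measure Ω} {S : Edge → Set Ω}
    (hP : ∀ e, P (S e) = seedWeight μ e) (hsum : ∑' e, seedWeight μ e ≠ ∞) :
    ∀ᵐ ω ∂P, {e | ω ∈ S e}.Finite :=
  ae_finite_setOfPred_mem (by simpa only [hP] using hsum)

lemma ae_infinite_seeds [IsFiniteMeasure μ] {Ω : Type*} [MeasurableSpace Ω] {P : Measure Ω}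
    [IsProbabilityMeasure P] {S : Edge → Set Ω} (hS : ∀ e, MeasurableSet (S e))
    (hP : ∀ e, P (S e) = seedWeight μ e)
    (htouch : ∀ e f, e ≠ f → Touch e f → P (S e ∩ S f) = 0)
    (hpair : ∀ e f, ¬ Touch e f → μ {e} ≠ 0 → μ {f} ≠ 0 → P (S e ∩ S f) ≤
      μ {e} / μ (star e ∪ star f) * seedWeight μ f + μ {f} / μ (star e ∪ star f) * seedWeight μ e)
    (hsum : ∑' e, seedWeight μ e = ∞) :
    ∀ᵐ ω ∂P, {e | ω ∈ S e}.Infinite := by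
  classical
  have hbound (e f : Edge) : P (S e ∩ S f) ≤ (if e = f then seedWeight μ e else 0) +
      (seedWeight μ e * seedWeight μ f +
        seedWeight μ e / μ (star e) * (seedWeight μ f * μ (star e ∩ star f))) := by
    by_cases hef : e = f
    · subst hef
      simp only [Set.inter_self, hP, if_true]
      exact le_self_add
    rw [if_neg hef, zero_add]
    by_cases ht : Touch e f
    · simp [htouch e f hef ht]
    by_cases he : μ {e} = 0
    · exact (measure_mono Set.inter_subset_left).trans (by simp [hP, seedWeight_eq_zero he])
    by_cases hf : μ {f} = 0
    · exact (measure_mono Set.inter_subset_right).trans (by simp [hP, seedWeight_eq_zero hf])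
    refine (hpair e f ht he hf).trans ?_
    refine ennreal_pair_le ?_ ?_ (measure_ne_top _ _) (measure_mono Set.subset_union_left)
      (measure_mono Set.subset_union_right)
      (measure_union_add_inter _ MeasurableSet.of_discrete).symm
    · exact fun h => he (le_antisymm ((mass_le_star e).trans h.le) zero_le)
    · exact fun h => hf (le_antisymm ((mass_le_star f).trans h.le) zero_le)
  -- The diagonal contributes `1` to the constant, the overlapping stars `2`.
  refine ae_infinite_of_second_moment hS 3 (by simpa only [hP] using hsum) fun F => ?_
  have hlast (e : Edge) : seedWeight μ e / μ (star e) *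
      ∑ f ∈ F, seedWeight μ f * μ (star e ∩ star f) ≤ 2 * seedWeight μ e := by
    by_cases he : μ (star e) = 0
    · have : μ {e} = 0 := le_antisymm ((mass_le_star e).trans he.le) zero_le
      simp [seedWeight_eq_zero this]
    calc _ ≤ seedWeight μ e / μ (star e) * (2 * μ (star e)) := by
          gcongr
          exact (ENNReal.sum_le_tsum F).trans (tsum_seedWeight_mul_inter_le e)
      _ = 2 * (seedWeight μ e / μ (star e) * μ (star e)) := by ring
      _ = _ := by rw [ENNReal.div_mul_cancel he (measure_ne_top _ _)]
  calc ∑ e ∈ F, ∑ f ∈ F, P (S e ∩ S f)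
      ≤ ∑ e ∈ F, ∑ f ∈ F, ((if e = f then seedWeight μ e else 0) +
          (seedWeight μ e * seedWeight μ f +
            seedWeight μ e / μ (star e) * (seedWeight μ f * μ (star e ∩ star f)))) := by
        gcongr; exact hbound _ _
    _ = ∑ e ∈ F, seedWeight μ e + ((∑ e ∈ F, seedWeight μ e) ^ 2 +
          ∑ e ∈ F, seedWeight μ e / μ (star e) *
            ∑ f ∈ F, seedWeight μ f * μ (star e ∩ star f)) := by
        simp only [Finset.sum_add_distrib]
        rw [sq, Finset.sum_mul_sum]
        simp only [Finset.mul_sum]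
        congr 1
        exact Finset.sum_congr rfl fun e he => by simp [he]
    _ ≤ ∑ e ∈ F, seedWeight μ e + ((∑ e ∈ F, seedWeight μ e) ^ 2 +
          ∑ e ∈ F, 2 * seedWeight μ e) := by
        exact add_le_add_right (add_le_add_right (Finset.sum_le_sum fun e _ => hlast e) _) _
    _ = _ := by
        simp only [hP, ← Finset.mul_sum]
        push_cast
        ring

end

/-! ### Discrete time: first hits -/

/-- The set of edges sampled in the first `n` steps. -/
def sampledEdges (ξ : ℕ → Edge) (n : ℕ) : Set Edge := {e | ∃ k < n, ξ k = e}

lemma discreteGraph_eq (ξ : ℕ → Edge) (n : ℕ) :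
    discreteGraph ξ n = edgeGraph (sampledEdges ξ n) := by
  induction n with
  | zero =>
    refine SimpleGraph.Subgraph.ext ?_ ?_
    · ext v; simp [discreteGraph, edgeGraph, sampledEdges]
    · ext u v; simp [discreteGraph, edgeGraph, sampledEdges]
  | succ n ih =>
    have key (p : Edge → Prop) : (∃ e ∈ sampledEdges ξ (n + 1), p e) ↔
        (∃ e ∈ sampledEdges ξ n, p e) ∨ ∃ e ∈ ({ξ n} : Set Edge), p e := by
      constructor
      · rintro ⟨e, ⟨k, hk, rfl⟩, hp⟩
        rcases Nat.lt_succ_iff_lt_or_eq.1 hk with hk | rfl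
        · exact Or.inl ⟨_, ⟨k, hk, rfl⟩, hp⟩
        · exact Or.inr ⟨_, rfl, hp⟩
      · rintro (⟨e, ⟨k, hk, rfl⟩, hp⟩ | ⟨e, rfl, hp⟩)
        · exact ⟨_, ⟨k, hk.trans n.lt_succ_self, rfl⟩, hp⟩
        · exact ⟨_, ⟨n, n.lt_succ_self, rfl⟩, hp⟩
    rw [discreteGraph, ih]
    refine SimpleGraph.Subgraph.ext ?_ ?_
    · ext v; exact (key _).symm
    · ext u v; exact (key _).symm

lemma sampledEdges_mono (ξ : ℕ → Edge) : Monotone (sampledEdges ξ) :=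
  fun _ _ hmn _ ⟨k, hk, h⟩ => ⟨k, hk.trans_le hmn, h⟩

lemma sampledEdges_finite (ξ : ℕ → Edge) (n : ℕ) : (sampledEdges ξ n).Finite :=
  ((Set.finite_Iio n).image ξ).subset fun _ ⟨k, hk, h⟩ => ⟨k, hk, h⟩

/-- The first sampled edge in `A` is `e`. -/
def FirstHit (A : Set Edge) (e : Edge) (ξ : ℕ → Edge) : Prop :=
  ∃ n, ξ n = e ∧ ∀ k < n, ξ k ∉ A

lemma FirstHit.isSeed {e : Edge} {ξ : ℕ → Edge} (h : FirstHit (star e) e ξ) :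
    IsSeed (sampledEdges ξ) e := by
  obtain ⟨n, hn, hlt⟩ := h
  refine ⟨n + 1, ⟨n, n.lt_succ_self, hn⟩, ?_⟩
  rintro f ⟨k, hk, rfl⟩ hf
  refine hlt k ((Nat.lt_succ_iff.1 hk).lt_of_ne ?_)
  rintro rfl
  exact hf hn

lemma exists_joined_firstHit (ξ : ℕ → Edge) (n : ℕ) :
    ∀ e ∈ sampledEdges ξ n, ∀ u ∈ (e : Sym2 ℕ),
      ∃ r ∈ sampledEdges ξ n ∩ {e | FirstHit (star e) e ξ}, ∃ v ∈ (r : Sym2 ℕ),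
        Joined (sampledEdges ξ n) u v := by
  -- The rank is the first sampling time; the value `sInf ∅ = 0` is harmless, as only sampled edges
  -- are compared.
  refine exists_joined_of_rank (fun e => sInf {k | ξ k = e}) (sampledEdges_finite ξ n) ?_
  rintro e ⟨k, hk, he⟩
  have hmem : ξ (sInf {k | ξ k = e}) = e := Nat.sInf_mem (s := {k | ξ k = e}) ⟨k, he⟩
  have hle : sInf {k | ξ k = e} ≤ k := Nat.sInf_le he
  by_cases h : ∀ j < sInf {k | ξ k = e}, ξ j ∉ star e
  · exact Or.inl ⟨_, hmem, h⟩
  · push Not at h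
    obtain ⟨j, hj, hje⟩ := h
    refine Or.inr ⟨ξ j, ⟨j, (hj.trans_le hle).trans hk, rfl⟩, hje, lt_of_le_of_lt ?_ hj⟩
    exact Nat.sInf_le (s := {k | ξ k = ξ j}) rfl

lemma firstHit_inter_of_touch {e f : Edge} (hef : e ≠ f) (ht : Touch e f) {ξ : ℕ → Edge}
    (he : FirstHit (star e) e ξ) (hf : FirstHit (star f) f ξ) : False := by
  obtain ⟨n, hn, hn'⟩ := he
  obtain ⟨m, hm, hm'⟩ := hf
  rcases lt_trichotomy n m with h | rfl | h
  · exact hm' n h (hn ▸ ht.symm)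
  · exact hef (hn.symm.trans hm)
  · exact hn' m h (hm ▸ ht)

section

variable {μ : Measure Edge} {Ω : Type*} [MeasurableSpace Ω] {P : Measure Ω} {ξ : ℕ → Ω → Edge}

lemma IsIIDSample.measure_forall_lt (hξ : IsIIDSample ξ μ P) (C : ℕ → Set Edge) (n : ℕ) :
    P {ω | ∀ k < n, ξ k ω ∈ C k} = ∏ k ∈ Finset.range n, μ (C k) := by
  have h := hξ.indep.measure_inter_preimage_eq_mul (Finset.range n) (sets := C)
    fun _ _ => MeasurableSet.of_discrete
  have h1 : {ω | ∀ k < n, ξ k ω ∈ C k} = ⋂ k ∈ Finset.range n, ξ k ⁻¹' C k := by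
    ext ω; simp
  rw [h1, h]
  refine Finset.prod_congr rfl fun k _ => ?_
  rw [← (hξ.law k).map_eq, Measure.map_apply (hξ.measurable k) MeasurableSet.of_discrete]

lemma IsIIDSample.measurableSet_firstHit (hξ : IsIIDSample ξ μ P) (A : Set Edge) (e : Edge) :
    MeasurableSet {ω | FirstHit A e fun n => ξ n ω} := by
  have : {ω | FirstHit A e fun n => ξ n ω} =
      ⋃ n, (ξ n ⁻¹' {e} ∩ ⋂ k, ⋂ (_ : k < n), ξ k ⁻¹' Aᶜ) := by
    ext ω; simp [FirstHit]
  rw [this]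
  exact MeasurableSet.iUnion fun n => (hξ.measurable n MeasurableSet.of_discrete).inter
    (MeasurableSet.iInter fun k => MeasurableSet.iInter fun _ =>
      hξ.measurable k MeasurableSet.of_discrete)

variable [IsProbabilityMeasure μ]

/-- This remains true for `μ A = 0`, where both sides are `∞`. -/
lemma tsum_geometric_compl (A : Set Edge) : ∑' n : ℕ, μ Aᶜ ^ n = (μ A)⁻¹ := by
  rw [ENNReal.tsum_geometric, prob_compl_eq_one_sub MeasurableSet.of_discrete,
    ENNReal.sub_sub_cancel ENNReal.one_ne_top prob_le_one]

lemma IsIIDSample.measure_firstHit (hξ : IsIIDSample ξ μ P) {A : Set Edge} {e : Edge}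
    (he : e ∈ A) : P {ω | FirstHit A e fun n => ξ n ω} = μ {e} / μ A := by
  have h1 : {ω | FirstHit A e fun n => ξ n ω} =
      ⋃ n, {ω | ∀ k < n + 1, ξ k ω ∈ if k < n then Aᶜ else {e}} := by
    ext ω
    simp only [FirstHit, Set.mem_ofPred_eq, Set.mem_iUnion]
    refine exists_congr fun n => ⟨fun ⟨h, h'⟩ k hk => ?_, fun h => ⟨?_, fun k hk => ?_⟩⟩
    · split_ifs with hkn
      · exact h' k hkn
      · obtain rfl : k = n := by omega
        exact h
    · simpa using h n n.lt_succ_self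
    · simpa [hk] using h k (by omega)
  rw [h1, measure_iUnion]
  · have (n : ℕ) : P {ω | ∀ k < n + 1, ξ k ω ∈ if k < n then Aᶜ else {e}} =
        μ Aᶜ ^ n * μ {e} := by
      rw [hξ.measure_forall_lt (fun k => if k < n then Aᶜ else {e}), Finset.prod_range_succ,
        if_neg (lt_irrefl _), Finset.prod_congr rfl (g := fun _ => μ Aᶜ)]
      · simp
      · intro k hk
        rw [if_pos (Finset.mem_range.1 hk)]
    simp_rw [this]
    rw [ENNReal.tsum_mul_right, tsum_geometric_compl, div_eq_mul_inv, mul_comm]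
  · have key (ω : Ω) (m n : ℕ) (hmn : m < n)
        (hm : ∀ k < m + 1, ξ k ω ∈ if k < m then Aᶜ else {e})
        (hn : ∀ k < n + 1, ξ k ω ∈ if k < n then Aᶜ else {e}) : False := by
      have hm' : ξ m ω = e := by simpa using hm m m.lt_succ_self
      have hn' : ξ m ω ∉ A := by simpa [hmn] using hn m (by omega)
      exact hn' (hm' ▸ he)
    intro m n hmn
    refine Set.disjoint_left.2 fun ω hm hn => ?_
    rcases lt_or_gt_of_ne hmn with h | h
    · exact key ω m n h hm hn
    · exact key ω n m h hn hm
  · intro n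
    have : {ω | ∀ k < n + 1, ξ k ω ∈ if k < n then Aᶜ else {e}} =
        ⋂ k, ⋂ (_ : k < n + 1), ξ k ⁻¹' (if k < n then Aᶜ else {e}) := by
      ext ω; simp
    rw [this]
    exact MeasurableSet.iInter fun k => MeasurableSet.iInter fun _ =>
      hξ.measurable k MeasurableSet.of_discrete

lemma IsIIDSample.measure_firstHit_pair_le (hξ : IsIIDSample ξ μ P) (U B : Set Edge)
    (e f : Edge) :
    P {ω | ∃ n m, n < m ∧ ξ n ω = e ∧ ξ m ω = f ∧ (∀ k < n, ξ k ω ∉ U) ∧ ∀ k < m, ξ k ω ∉ B} ≤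
      μ {e} / μ U * (μ {f} / μ B) := by
  -- The pattern is `n` samples outside `U`, then `e`, then `j` samples outside `B`, then `f`.
  -- Summing over `n` and `j` gives two geometric series.
  let C (n j k : ℕ) : Set Edge :=
    if k < n then Uᶜ else if k = n then {e} else if k < n + 1 + j then Bᶜ else {f}
  have hsub : {ω | ∃ n m, n < m ∧ ξ n ω = e ∧ ξ m ω = f ∧ (∀ k < n, ξ k ω ∉ U) ∧
      ∀ k < m, ξ k ω ∉ B} ⊆ ⋃ n, ⋃ j, {ω | ∀ k < n + 1 + j + 1, ξ k ω ∈ C n j k} := by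
    rintro ω ⟨n, m, hnm, he, hf, hU, hB⟩
    obtain ⟨j, rfl⟩ := Nat.exists_eq_add_of_le hnm
    refine Set.mem_iUnion.2 ⟨n, Set.mem_iUnion.2 ⟨j, fun k hk => ?_⟩⟩
    simp only [C]
    split_ifs with h1 h2 h3
    · exact hU k h1
    · exact h2 ▸ he
    · exact hB k h3
    · obtain rfl : k = n + 1 + j := by omega
      exact hf
  have hC (n j : ℕ) : P {ω | ∀ k < n + 1 + j + 1, ξ k ω ∈ C n j k} =
      μ Uᶜ ^ n * μ {e} * (μ Bᶜ ^ j * μ {f}) := by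
    have h1 : ∀ k ∈ Finset.range n, μ (C n j k) = μ Uᶜ := fun k hk => by
      simp [C, Finset.mem_range.1 hk]
    have h2 : ∀ k ∈ Finset.range j, μ (C n j (n + 1 + k)) = μ Bᶜ := fun k hk => by
      have := Finset.mem_range.1 hk
      simp only [C]
      rw [if_neg (by omega), if_neg (by omega), if_pos (by omega)]
    have h3 : C n j n = {e} := by simp [C]
    have h4 : C n j (n + 1 + j) = {f} := by
      simp only [C]
      rw [if_neg (by omega), if_neg (by omega), if_neg (by omega)]
    rw [hξ.measure_forall_lt, Finset.prod_range_succ, Finset.prod_range_add,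
      Finset.prod_range_succ, Finset.prod_congr rfl h1, Finset.prod_congr rfl h2, h3, h4]
    simp [mul_assoc]
  calc _ ≤ ∑' n, ∑' j, P {ω | ∀ k < n + 1 + j + 1, ξ k ω ∈ C n j k} :=
        (measure_mono hsub).trans ((measure_iUnion_le _).trans
          (ENNReal.tsum_le_tsum fun n => measure_iUnion_le _))
    _ = _ := by
        simp_rw [hC, ENNReal.tsum_mul_left, ENNReal.tsum_mul_right, tsum_geometric_compl]
        simp only [div_eq_mul_inv]
        ring

/-- Split by which seed comes first: before it neither star is hit, and up to the second seed that
seed's own star is not hit. -/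
lemma IsIIDSample.measure_firstHit_inter_le (hξ : IsIIDSample ξ μ P) {e f : Edge}
    (ht : ¬ Touch e f) :
    P ({ω | FirstHit (star e) e fun n => ξ n ω} ∩ {ω | FirstHit (star f) f fun n => ξ n ω}) ≤
      μ {e} / μ (star e ∪ star f) * seedWeight μ f +
        μ {f} / μ (star e ∪ star f) * seedWeight μ e := by
  refine le_trans (measure_mono ?_) ((measure_union_le _ _).trans (add_le_add
    (hξ.measure_firstHit_pair_le (star e ∪ star f) (star f) e f)
    (hξ.measure_firstHit_pair_le (star e ∪ star f) (star e) f e)))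
  rintro ω ⟨⟨n, hn, hn'⟩, m, hm, hm'⟩
  rcases lt_trichotomy n m with h | rfl | h
  · exact Or.inl ⟨n, m, h, hn, hm,
      fun k hk hU => hU.elim (hn' k hk) (hm' k (hk.trans h)), hm'⟩
  · exact absurd (hn.symm.trans hm ▸ touch_self e) ht
  · exact Or.inr ⟨m, n, h, hm, hn,
      fun k hk hU => hU.elim (hn' k (hk.trans h)) (hm' k hk), hn'⟩

lemma IsIIDSample.ae_mem_iff (hξ : IsIIDSample ξ μ P) [IsProbabilityMeasure P] :
    ∀ᵐ ω ∂P, ∀ e, e ∈ {e | 0 < μ {e}} ↔ ∃ n, e ∈ sampledEdges (fun n => ξ n ω) n := by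
  rw [ae_all_iff]
  intro e
  by_cases he : μ {e} = 0
  · have : ∀ᵐ ω ∂P, ∀ n, ξ n ω ≠ e := by
      rw [ae_all_iff]
      intro n
      rw [ae_iff]
      simp only [ne_eq, not_not]
      have := Measure.map_apply (hξ.measurable n) (μ := P)
        (MeasurableSet.of_discrete (s := ({e} : Set Edge)))
      rw [(hξ.law n).map_eq, he] at this
      exact this.symm
    filter_upwards [this] with ω hω
    refine iff_of_false (by simp [he]) ?_
    rintro ⟨n, k, -, h⟩
    exact hω k h
  · have h1 := hξ.measure_firstHit (Set.mem_singleton e)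
    rw [ENNReal.div_self he (measure_ne_top _ _),
      ← prob_compl_eq_zero_iff (hξ.measurableSet_firstHit _ _)] at h1
    filter_upwards [show ∀ᵐ ω ∂P, FirstHit {e} e fun n => ξ n ω from h1] with ω hω
    obtain ⟨n, hn, -⟩ := hω
    exact iff_of_true (pos_iff_ne_zero.2 he) ⟨n + 1, n, n.lt_succ_self, hn⟩

lemma support_nonempty : {e | 0 < μ {e}}.Nonempty := by
  by_contra h
  rw [Set.not_nonempty_iff_eq_empty] at h
  have h0 (e : Edge) : μ {e} = 0 := by
    by_contra he
    exact (h ▸ pos_iff_ne_zero.2 he : e ∈ (∅ : Set Edge))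
  have h1 := Measure.tsum_indicator_apply_singleton μ Set.univ MeasurableSet.univ
  simp [h0] at h1

theorem IsIIDSample.ae_connected (hξ : IsIIDSample ξ μ P) [IsProbabilityMeasure P]
    (hconn : (supportGraph μ).Connected) (hsum : ∑' e, seedWeight μ e ≠ ∞) :
    ∀ᵐ ω ∂P, EventuallyForever SimpleGraph.Subgraph.Connected
      (discreteGraph fun n => ξ n ω) := by
  filter_upwards [hξ.ae_mem_iff, ae_finite_seeds (fun e => hξ.measure_firstHit (touch_self e)) hsum]
    with ω hω hfin
  rw [show discreteGraph (fun n => ξ n ω) = fun n => edgeGraph (sampledEdges (fun n => ξ n ω) n)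
    from funext fun n => discreteGraph_eq _ n]
  exact eventuallyForever_connected (sampledEdges_mono _) hω hconn hfin
    fun n => exists_joined_firstHit _ n

theorem IsIIDSample.ae_not_connected (hξ : IsIIDSample ξ μ P) [IsProbabilityMeasure P]
    (h : ¬ (supportGraph μ).Connected ∨ ∑' e, seedWeight μ e = ∞) :
    ∀ᵐ ω ∂P, ¬ EventuallyForever SimpleGraph.Subgraph.Connected
      (discreteGraph fun n => ξ n ω) := by
  simp_rw [show ∀ ω, discreteGraph (fun n => ξ n ω) =
    fun n => edgeGraph (sampledEdges (fun n => ξ n ω) n)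
    from fun ω => funext fun n => discreteGraph_eq _ n]
  rcases h with h | h
  · filter_upwards [hξ.ae_mem_iff] with ω hω
    exact not_eventuallyForever_of_not_connected (sampledEdges_mono _) hω support_nonempty h
  · filter_upwards [ae_infinite_seeds (fun e => hξ.measurableSet_firstHit (star e) e)
      (fun e => hξ.measure_firstHit (touch_self e))
      (fun e f hef ht => measure_mono_null (fun ω hω =>
        firstHit_inter_of_touch hef ht hω.1 hω.2) measure_empty)
      (fun e f ht _ _ => hξ.measure_firstHit_inter_le ht) h] with ω hω
    exact not_eventuallyForever_of_infinite_seeds (sampledEdges_mono _) (sampledEdges_finite _)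
      (hω.mono fun e he => FirstHit.isSeed he)

end

/-! ### Continuous time: arrival times and exponential races -/

/-- The time of the first arrival of a counting process. -/
noncomputable def arrival (x : ℝ≥0 → ℕ) : ℝ≥0∞ :=
  ⨅ n, if 0 < x (TopologicalSpace.denseSeq ℝ≥0 n) then
    (TopologicalSpace.denseSeq ℝ≥0 n : ℝ≥0∞) else ∞

/-- Taking the infimum over a countable dense set of times gives measurability on all paths, with no
regularity assumed. -/
lemma measurable_arrival : Measurable arrival := by
  refine Measurable.iInf fun n => ?_
  refine Measurable.ite ?_ measurable_const measurable_const
  exact (measurable_pi_apply (X := fun _ : ℝ≥0 => ℕ) _) (MeasurableSet.of_discrete (s := {k | 0 < k}))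

lemma lt_arrival_iff {x : ℝ≥0 → ℕ} (hm : Monotone x)
    (hc : ∀ t, ContinuousWithinAt x (Set.Ici t) t) (t : ℝ≥0) : t < arrival x ↔ x t = 0 := by
  constructor
  · intro h
    by_contra hx
    obtain ⟨r, htr, hr⟩ := ENNReal.lt_iff_exists_nnreal_btwn.1 h
    obtain ⟨n, hn⟩ := (TopologicalSpace.denseRange_denseSeq ℝ≥0).exists_mem_open isOpen_Ioo
      (Set.nonempty_Ioo.2 (ENNReal.coe_lt_coe.1 htr))
    have hpos : 0 < x (TopologicalSpace.denseSeq ℝ≥0 n) :=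
      (Nat.pos_of_ne_zero hx).trans_le (hm hn.1.le)
    have hle : arrival x ≤ TopologicalSpace.denseSeq ℝ≥0 n := (iInf_le _ n).trans (by simp [hpos])
    exact (hr.trans_le hle).not_ge (ENNReal.coe_le_coe.2 hn.2.le)
  · intro hx
    -- Right-continuity keeps the path at `0` slightly beyond `t`, which makes the inequality
    -- strict.
    have h0 : ∀ᶠ s in nhdsWithin t (Set.Ici t), x s = 0 := by
      have := (hc t) (IsOpen.mem_nhds (isOpen_discrete {k | k = 0}) hx)
      exact this
    obtain ⟨u, hu, hsub⟩ := mem_nhdsGE_iff_exists_Ico_subset.1 h0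
    refine (ENNReal.coe_lt_coe.2 hu).trans_le (le_iInf fun n => ?_)
    split_ifs with hn
    · refine ENNReal.coe_le_coe.2 (not_lt.1 fun hlt => ?_)
      rcases le_total t (TopologicalSpace.denseSeq ℝ≥0 n) with h | h
      · exact hn.ne' (hsub ⟨h, hlt⟩)
      · exact hn.ne' (Nat.le_zero.1 (hx ▸ hm h))
    · exact le_top

section

variable {Ω : Type*} [MeasurableSpace Ω] {P : Measure Ω} [IsProbabilityMeasure P]

lemma map_eq_of_tail {T : Ω → ℝ≥0∞} (hT : Measurable T) {a : ℝ} (ha : 0 < a)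
    (h : ∀ t : ℝ≥0, P {ω | t < T ω} = ENNReal.ofReal (Real.exp (-(a * t)))) :
    P.map T = (expMeasure a).map ENNReal.ofReal := by
  have := isProbabilityMeasure_expMeasure ha
  have := Measure.isProbabilityMeasure_map (μ := P) hT.aemeasurable
  have := Measure.isProbabilityMeasure_map (μ := expMeasure a)
    ENNReal.measurable_ofReal.aemeasurable
  refine Measure.ext_of_Iic _ _ fun t => ?_
  induction t with
  | top => simp
  | coe t =>
    rw [Measure.map_apply hT measurableSet_Iic,
      Measure.map_apply ENNReal.measurable_ofReal measurableSet_Iic]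
    have h1 : T ⁻¹' Set.Iic (t : ℝ≥0∞) = {ω | t < T ω}ᶜ := by
      ext ω; simp
    have h2 : ENNReal.ofReal ⁻¹' Set.Iic (t : ℝ≥0∞) = Set.Iic (t : ℝ) := by
      ext x; simp [ENNReal.ofReal_le_iff_le_toReal]
    rw [h1, prob_compl_eq_one_sub (measurableSet_lt measurable_const hT), h, h2, ← ofReal_cdf,
      cdf_expMeasure_eq ha, if_pos (NNReal.coe_nonneg t), ENNReal.ofReal_sub _ (Real.exp_pos _).le,
      ENNReal.ofReal_one]

/-- The race between an exponential clock `T` and an independent family of events whose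
probabilities decay exponentially in time. -/
lemma measure_race {β : Type*} [MeasurableSpace β] {T : Ω → ℝ≥0∞} {Y : Ω → β} (hT : Measurable T)
    (hY : Measurable Y) (hind : IndepFun T Y P) {a b c : ℝ} (ha : 0 < a) (hb : 0 ≤ b) (hc : 0 ≤ c)
    (h : ∀ t : ℝ≥0, P {ω | t < T ω} = ENNReal.ofReal (Real.exp (-(a * t))))
    {C : Set (ℝ≥0∞ × β)} (hC : MeasurableSet C)
    (hCt : ∀ t : ℝ≥0, P {ω | ((t : ℝ≥0∞), Y ω) ∈ C} = ENNReal.ofReal (c * Real.exp (-(b * t))))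
    (s : ℝ≥0) :
    P {ω | s < T ω ∧ (T ω, Y ω) ∈ C} =
      ENNReal.ofReal (a / (a + b) * c * Real.exp (-((a + b) * s))) := by
  have hD : MeasurableSet ({p : ℝ≥0∞ × β | s < p.1} ∩ C) :=
    (measurableSet_lt measurable_const measurable_fst).inter hC
  have hab : 0 < a + b := by positivity
  have h1 : {ω | s < T ω ∧ (T ω, Y ω) ∈ C} =
      (fun ω => (T ω, Y ω)) ⁻¹' ({p : ℝ≥0∞ × β | s < p.1} ∩ C) := rfl
  have hslice : Measurable fun t => (P.map Y) (Prod.mk t ⁻¹' ({p : ℝ≥0∞ × β | s < p.1} ∩ C)) := by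
    have := Measure.isProbabilityMeasure_map (μ := P) hY.aemeasurable
    exact measurable_measure_prodMk_left hD
  have hpdf : Measurable (gammaPDF 1 a) := (measurable_gammaPDFReal 1 a).ennreal_ofReal
  have := Measure.isProbabilityMeasure_map (μ := P) hY.aemeasurable
  -- By independence the probability is the integral of `a * exp (-a x) * c * exp (-b x)` over `x >
  -- s`.
  rw [h1, ← Measure.map_apply (hT.prodMk hY) hD,
    (indepFun_iff_map_prod_eq_prod_map_map hT.aemeasurable hY.aemeasurable).1 hind,
    Measure.prod_apply hD, map_eq_of_tail hT ha h,
    lintegral_map hslice ENNReal.measurable_ofReal, expMeasure, gammaMeasure,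
    lintegral_withDensity_eq_lintegral_mul _ hpdf
      (g := fun x => (P.map Y) (Prod.mk (ENNReal.ofReal x) ⁻¹' ({p : ℝ≥0∞ × β | s < p.1} ∩ C)))
      (hslice.comp ENNReal.measurable_ofReal)]
  have hint : ∀ x : ℝ, (gammaPDF 1 a * fun x : ℝ => (P.map Y) (Prod.mk (ENNReal.ofReal x) ⁻¹'
      ({p : ℝ≥0∞ × β | s < p.1} ∩ C))) x = (Set.Ioi (s : ℝ)).indicator
        (fun x => ENNReal.ofReal (a * c * Real.exp (-(a + b) * x))) x := by
    intro x
    by_cases hx : (s : ℝ) < x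
    · have hx0 : 0 ≤ x := s.2.trans hx.le
      have hpre : Prod.mk (ENNReal.ofReal x) ⁻¹' ({p : ℝ≥0∞ × β | s < p.1} ∩ C) =
          Prod.mk (ENNReal.ofReal x) ⁻¹' C := by
        ext y
        have : (s : ℝ≥0∞) < ENNReal.ofReal x := by
          rwa [ENNReal.lt_ofReal_iff_toReal_lt ENNReal.coe_ne_top]
        simp [this]
      have hx' := hCt x.toNNReal
      rw [Real.coe_toNNReal x hx0] at hx'
      rw [Set.indicator_of_mem (Set.mem_Ioi.2 hx), Pi.mul_apply, hpre, Measure.map_apply hY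
        (measurable_prodMk_left hC)]
      change exponentialPDF a x * P {ω | ((x.toNNReal : ℝ≥0∞), Y ω) ∈ C} = _
      rw [hx', exponentialPDF_of_nonneg hx0, ← ENNReal.ofReal_mul (by positivity)]
      congr 1
      rw [show -(a + b) * x = -(a * x) + -(b * x) by ring, Real.exp_add]
      ring
    · have hpre : Prod.mk (ENNReal.ofReal x) ⁻¹' ({p : ℝ≥0∞ × β | s < p.1} ∩ C) = ∅ := by
        ext y
        have : ¬ (s : ℝ≥0∞) < ENNReal.ofReal x := by
          rwa [ENNReal.lt_ofReal_iff_toReal_lt ENNReal.coe_ne_top]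
        simp [this]
      rw [Set.indicator_of_notMem (by simpa using hx), Pi.mul_apply, hpre, measure_empty, mul_zero]
  rw [lintegral_congr hint, lintegral_indicator measurableSet_Ioi,
    ← ofReal_integral_eq_lintegral_ofReal]
  · rw [integral_const_mul, integral_exp_mul_Ioi (by linarith)]
    congr 1
    rw [neg_mul]
    field_simp
  · exact (integrableOn_exp_mul_Ioi (by linarith) _).const_mul _
  · exact Filter.Eventually.of_forall fun x => by positivity

end

lemma indepFun_restrict_of_disjoint {Ω ι : Type*} [MeasurableSpace Ω] {P : Measure Ω}
    {α : Type*} [MeasurableSpace α] {T : ι → Ω → α} (hT : ∀ i, Measurable (T i))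
    (hind : iIndepFun T P) {A B : Set ι} (hAB : Disjoint A B) :
    IndepFun (fun ω (i : A) => T i ω) (fun ω (i : B) => T i ω) P := by
  have h := indep_iSup_of_disjoint (fun i => (hT i).comap_le) hind.iIndep hAB
  have key (A : Set ι) : MeasurableSpace.comap (fun ω (i : A) => T i ω) MeasurableSpace.pi =
      ⨆ i ∈ A, MeasurableSpace.comap (T i) inferInstance := by
    rw [MeasurableSpace.pi, MeasurableSpace.comap_iSup, iSup_subtype]
    simp only [MeasurableSpace.comap_comp]
    rfl
  rw [IndepFun_iff_Indep, key, key]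
  exact h

/-! ### Exponential clocks on the edges -/

/-- Independent exponential clocks, the clock of the edge `e` having rate `μ {e}` (it never rings
if `μ {e} = 0`). -/
structure IsExponentialClocks {Ω : Type*} [MeasurableSpace Ω] (T : Edge → Ω → ℝ≥0∞)
    (μ : Measure Edge) (P : Measure Ω) : Prop where
  measurable : ∀ e, Measurable (T e)
  indep : iIndepFun T P
  tail : ∀ e, ∀ t : ℝ≥0, P {ω | t < T e ω} = ENNReal.ofReal (Real.exp (-(μ.real {e} * t)))

/-- The clock of `e` rings, and does so before those of all other edges in `A`. -/
def FirstRing (A : Set Edge) (e : Edge) (T : Edge → ℝ≥0∞) : Prop :=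
  T e ≠ ∞ ∧ ∀ f ∈ A, f ≠ e → T e < T f

lemma measurableSet_firstRing (A : Set Edge) (e : Edge) :
    MeasurableSet {x : Edge → ℝ≥0∞ | FirstRing A e x} := by
  have : {x : Edge → ℝ≥0∞ | FirstRing A e x} =
      {x | x e = ∞}ᶜ ∩ ⋂ f, ⋂ (_ : f ∈ A), ⋂ (_ : f ≠ e), {x | x e < x f} := by
    ext x; simp [FirstRing]
  rw [this]
  refine (measurableSet_eq_fun (measurable_pi_apply e) measurable_const).compl.inter ?_
  exact MeasurableSet.iInter fun f => MeasurableSet.iInter fun _ => MeasurableSet.iInter fun _ =>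
    measurableSet_lt (measurable_pi_apply e) (measurable_pi_apply f)

namespace IsExponentialClocks

variable {μ : Measure Edge} {Ω : Type*} [MeasurableSpace Ω]
  {P : Measure Ω} {T : Edge → Ω → ℝ≥0∞}

lemma measurableSet_firstRing (hT : IsExponentialClocks T μ P) (A : Set Edge) (e : Edge) :
    MeasurableSet {ω | FirstRing A e fun f => T f ω} :=
  (measurable_pi_lambda _ hT.measurable) (EdgeExchangeable.measurableSet_firstRing A e)

lemma measurable_compl (hT : IsExponentialClocks T μ P) (e : Edge) :
    Measurable fun ω (f : ({e}ᶜ : Set Edge)) => T f ω :=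
  measurable_pi_lambda _ fun f => hT.measurable f

lemma indepFun_compl (hT : IsExponentialClocks T μ P) (e : Edge) :
    IndepFun (T e) (fun ω (f : ({e}ᶜ : Set Edge)) => T f ω) P := by
  have h := indepFun_restrict_of_disjoint hT.measurable hT.indep
    (Set.disjoint_compl_right_iff_subset.2 (subset_refl {e}))
  exact h.comp (φ := fun x : ({e} : Set Edge) → ℝ≥0∞ => x ⟨e, rfl⟩) (ψ := id)
    (measurable_pi_apply _) measurable_id

variable [IsProbabilityMeasure P]

lemma ae_pos (hT : IsExponentialClocks T μ P) : ∀ᵐ ω ∂P, ∀ e, 0 < T e ω := by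
  rw [ae_all_iff]
  intro e
  have h := hT.tail e 0
  simp only [NNReal.coe_zero, mul_zero, neg_zero, Real.exp_zero, ENNReal.ofReal_one,
    ENNReal.coe_zero] at h
  rw [← prob_compl_eq_zero_iff (measurableSet_lt measurable_const (hT.measurable e))] at h
  exact h

lemma ae_top (hT : IsExponentialClocks T μ P) {e : Edge} (he : μ {e} = 0) :
    ∀ᵐ ω ∂P, T e ω = ∞ := by
  have h1 : ∀ᵐ ω ∂P, ∀ n : ℕ, (n : ℝ≥0) < T e ω := by
    rw [ae_all_iff]
    intro n
    have h := hT.tail e n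
    simp only [Measure.real, he, ENNReal.toReal_zero, zero_mul, neg_zero, Real.exp_zero,
      ENNReal.ofReal_one] at h
    rw [← prob_compl_eq_zero_iff (measurableSet_lt measurable_const (hT.measurable e))] at h
    exact h
  filter_upwards [h1] with ω hω
  exact ENNReal.eq_top_of_forall_nnreal_le fun r => by
    obtain ⟨n, hn⟩ := exists_nat_ge r
    exact (ENNReal.coe_le_coe.2 hn).trans (hω n).le

variable [IsProbabilityMeasure μ]

/-- `A` may be infinite: multiply the tails over finite sets of edges, then pass to the limit by
continuity from above. -/
lemma measure_forall_lt (hT : IsExponentialClocks T μ P) (A : Set Edge) (t : ℝ≥0) :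
    P {ω | ∀ f ∈ A, t < T f ω} = ENNReal.ofReal (Real.exp (-(μ.real A * t))) := by
  classical
  let C (f : Edge) : Set ℝ≥0∞ := if f ∈ A then Set.Ioi (t : ℝ≥0∞) else Set.univ
  have hC (f : Edge) : MeasurableSet (C f) := by
    simp only [C]; split_ifs
    · exact measurableSet_Ioi
    · exact MeasurableSet.univ
  let B (F : Finset Edge) : Set Ω := ⋂ f ∈ F, T f ⁻¹' C f
  have hB : ⋂ F, B F = {ω | ∀ f ∈ A, t < T f ω} := by
    ext ω
    simp only [B, Set.mem_iInter, Set.mem_preimage, Set.mem_ofPred_eq]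
    constructor
    · intro h f hf
      simpa [C, hf] using h {f} f (Finset.mem_singleton_self f)
    · intro h F f _
      by_cases hf : f ∈ A
      · simpa [C, hf] using h f hf
      · simp [C, hf]
  have hPB (F : Finset Edge) : P (B F) =
      ENNReal.ofReal (Real.exp (-((∑ f ∈ F, A.indicator (fun f => μ.real {f}) f) * t))) := by
    rw [hT.indep.measure_inter_preimage_eq_mul F fun f _ => hC f, Finset.sum_mul,
      ← Finset.sum_neg_distrib, Real.exp_sum,
      ENNReal.ofReal_prod_of_nonneg fun _ _ => (Real.exp_pos _).le]
    refine Finset.prod_congr rfl fun f _ => ?_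
    by_cases hf : f ∈ A
    · simp only [C, if_pos hf, Set.indicator_of_mem hf]
      exact hT.tail f t
    · simp [C, hf]
  have hsum : HasSum (A.indicator fun f => μ.real {f}) (μ.real A) := by
    have h1 := Measure.tsum_indicator_apply_singleton μ A MeasurableSet.of_discrete
    have h2 := ENNReal.hasSum_toReal (f := A.indicator fun f => μ {f})
      (by rw [h1]; exact measure_ne_top _ _)
    rw [← ENNReal.tsum_toReal_eq fun f => ne_top_of_le_ne_top (measure_ne_top μ {f})
      (Set.indicator_le_self _ _ f), h1] at h2
    refine (funext fun f => ?_ : A.indicator (fun f => μ.real {f}) = _) ▸ h2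
    by_cases hf : f ∈ A <;> simp [hf, Measure.real]
  have hlim : Filter.Tendsto (fun F => P (B F)) Filter.atTop
      (nhds (ENNReal.ofReal (Real.exp (-(μ.real A * t))))) := by
    simp_rw [hPB]
    exact ENNReal.tendsto_ofReal
      ((Real.continuous_exp.tendsto _).comp ((Filter.Tendsto.mul_const _ hsum).neg))
  rw [← hB]
  refine tendsto_nhds_unique (tendsto_measure_iInter_atTop (fun F => ?_) (fun F G hFG => ?_)
    ⟨∅, measure_ne_top _ _⟩) hlim
  · exact (Finset.measurableSet_biInter _ fun f _ => hT.measurable f (hC f)).nullMeasurableSet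
  · exact Set.biInter_subset_biInter_left hFG

/-- The clock of `e` races the clocks of `A \ {e}`, which all survive time `t` with probability `exp
(-μ(A \ {e}) t)`. -/
lemma measure_lt_firstRing (hT : IsExponentialClocks T μ P) {A : Set Edge} {e : Edge}
    (heA : e ∈ A) (he : μ {e} ≠ 0) (s : ℝ≥0) :
    P {ω | s < T e ω ∧ FirstRing A e fun f => T f ω} =
      ENNReal.ofReal (μ.real {e} / μ.real A * Real.exp (-(μ.real A * s))) := by
  let C : Set (ℝ≥0∞ × (({e}ᶜ : Set Edge) → ℝ≥0∞)) :=
    {p | p.1 = ∞}ᶜ ∩ ⋂ f : ({e}ᶜ : Set Edge), ⋂ (_ : (f : Edge) ∈ A), {p | p.1 < p.2 f}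
  have hC : MeasurableSet C := by
    refine (measurableSet_eq_fun measurable_fst measurable_const).compl.inter ?_
    exact MeasurableSet.iInter fun f => MeasurableSet.iInter fun _ =>
      measurableSet_lt measurable_fst ((measurable_pi_apply f).comp measurable_snd)
  have hCt (t : ℝ≥0) : P {ω | ((t : ℝ≥0∞), fun f : ({e}ᶜ : Set Edge) => T f ω) ∈ C} =
      ENNReal.ofReal (1 * Real.exp (-(μ.real (A \ {e}) * t))) := by
    rw [one_mul, ← hT.measure_forall_lt]
    congr 1
    ext ω
    simp only [C, Set.mem_inter_iff, Set.mem_compl_iff, Set.mem_ofPred_eq, Set.mem_iInter]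
    exact ⟨fun h f hf => h.2 ⟨f, hf.2⟩ hf.1,
      fun h => ⟨ENNReal.coe_ne_top, fun f hf => h f ⟨hf, f.2⟩⟩⟩
  have hsplit : μ.real {e} + μ.real (A \ {e}) = μ.real A := by
    rw [add_comm]
    have := measureReal_sdiff_add_inter (μ := μ) (s := A) (t := {e}) MeasurableSet.of_discrete
    rwa [Set.inter_eq_self_of_subset_right (Set.singleton_subset_iff.2 heA)] at this
  have h := measure_race (hT.measurable e) (hT.measurable_compl e)
    (hT.indepFun_compl e) (ENNReal.toReal_pos he (measure_ne_top _ _)) measureReal_nonneg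
    zero_le_one (hT.tail e) hC hCt s
  have hset : {ω | s < T e ω ∧ FirstRing A e fun f => T f ω} =
      {ω | s < T e ω ∧ (T e ω, fun f : ({e}ᶜ : Set Edge) => T f ω) ∈ C} := by
    ext ω
    simp only [C, FirstRing, Set.mem_inter_iff, Set.mem_compl_iff, Set.mem_ofPred_eq,
      Set.mem_iInter]
    exact and_congr_right fun _ => and_congr_right fun _ =>
      ⟨fun h f hf => h f hf f.2, fun h f hf hfe => h ⟨f, hfe⟩ hf⟩
  rw [hset, h, mul_one]
  change ENNReal.ofReal (μ.real {e} / (μ.real {e} + _) * Real.exp (-((μ.real {e} + _) * _))) = _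
  rw [hsplit]

lemma measure_firstRing (hT : IsExponentialClocks T μ P) {A : Set Edge} {e : Edge}
    (heA : e ∈ A) : P {ω | FirstRing A e fun f => T f ω} = μ {e} / μ A := by
  by_cases he : μ {e} = 0
  · rw [he, ENNReal.zero_div]
    refine measure_mono_null (fun ω hω => ?_) (hT.ae_top he)
    exact hω.1
  · have hA : 0 < μ A := (pos_iff_ne_zero.2 he).trans_le
      (measure_mono (Set.singleton_subset_iff.2 heA))
    have h := hT.measure_lt_firstRing heA he 0
    simp only [NNReal.coe_zero, mul_zero, neg_zero, Real.exp_zero, mul_one,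
      ENNReal.coe_zero, Measure.real] at h
    rw [ENNReal.ofReal_div_of_pos (ENNReal.toReal_pos hA.ne' (measure_ne_top _ _)),
      ENNReal.ofReal_toReal (measure_ne_top _ _), ENNReal.ofReal_toReal (measure_ne_top _ _)] at h
    rw [← h]
    refine measure_congr ?_
    filter_upwards [hT.ae_pos] with ω hω
    exact propext ⟨fun h => ⟨hω e, h⟩, fun h => h.2⟩

lemma ae_ne_top (hT : IsExponentialClocks T μ P) {e : Edge} (he : μ {e} ≠ 0) :
    ∀ᵐ ω ∂P, T e ω ≠ ∞ := by
  have h := hT.measure_firstRing (Set.mem_singleton e)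
  rw [ENNReal.div_self he (measure_ne_top _ _),
    ← prob_compl_eq_zero_iff (hT.measurableSet_firstRing _ _)] at h
  filter_upwards [show ∀ᵐ ω ∂P, FirstRing {e} e fun f => T f ω from h] with ω hω
  exact hω.1

/-- The probabilities that `e` rings before `f` and `f` before `e` add up to `1`. Ties at `∞` must
be allowed for edges of zero mass. -/
lemma ae_ne (hT : IsExponentialClocks T μ P) :
    ∀ᵐ ω ∂P, ∀ e f, e ≠ f → T e ω ≠ ∞ → T e ω ≠ T f ω := by
  rw [ae_all_iff]; intro e
  rw [ae_all_iff]; intro f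
  by_cases hef : e = f
  · exact Filter.Eventually.of_forall fun ω h => absurd hef h
  by_cases he : μ {e} = 0
  · filter_upwards [hT.ae_top he] with ω hω _ h
    exact absurd hω h
  by_cases hf : μ {f} = 0
  · filter_upwards [hT.ae_top hf] with ω hω _ h
    rwa [hω]
  have hdisj : Disjoint {ω | FirstRing {e, f} e fun g => T g ω}
      {ω | FirstRing {e, f} f fun g => T g ω} := by
    refine Set.disjoint_left.2 fun ω h1 h2 => ?_
    exact lt_asymm (h1.2 f (by simp) (Ne.symm hef)) (h2.2 e (by simp) hef)
  have hu := measure_union (μ := P) hdisj (hT.measurableSet_firstRing _ _)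
  have hmass : μ {e, f} = μ {e} + μ {f} := by
    rw [← measure_union (Set.disjoint_singleton.2 hef) MeasurableSet.of_discrete]
    rfl
  rw [hT.measure_firstRing (by simp), hT.measure_firstRing (by simp), ENNReal.div_add_div_same,
    ← hmass, ENNReal.div_self (by simp [hmass, he]) (measure_ne_top _ _),
    ← prob_compl_eq_zero_iff ((hT.measurableSet_firstRing _ _).union
      (hT.measurableSet_firstRing _ _))] at hu
  filter_upwards [show ∀ᵐ ω ∂P, ω ∈ {ω | FirstRing {e, f} e fun g => T g ω} ∪
      {ω | FirstRing {e, f} f fun g => T g ω} from hu] with ω hω _ _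
  rcases hω with h | h
  · exact (h.2 f (by simp) (Ne.symm hef)).ne
  · exact (h.2 e (by simp) hef).ne'

lemma measure_firstRing_pair_le (hT : IsExponentialClocks T μ P) {e f : Edge}
    (ht : ¬ Touch e f) (he : μ {e} ≠ 0) (hf : μ {f} ≠ 0) :
    P {ω | T e ω < T f ω ∧ FirstRing (star e) e (fun g => T g ω) ∧
      FirstRing (star f) f fun g => T g ω} ≤
      μ {e} / μ (star e ∪ star f) * seedWeight μ f := by
  have hfe : f ≠ e := fun h => ht (h ▸ touch_self e)
  have hne {g : Edge} (hg : g ∈ star f) : g ≠ e := fun h => ht (h ▸ Touch.symm hg)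
  -- Given `T e = t`, the clocks in `D` must outlast `t`, and `f` must ring after `t` and first in
  -- `star f`. As `D` and `star f` are disjoint, these conditions are independent; with `e` itself
  -- the rates total `μ (star e ∪ star f)`.
  let D : Set Edge := (star e \ star f) \ {e}
  let C : Set (ℝ≥0∞ × (({e}ᶜ : Set Edge) → ℝ≥0∞)) :=
    (⋂ g : ({e}ᶜ : Set Edge), ⋂ (_ : (g : Edge) ∈ D), {p | p.1 < p.2 g}) ∩
      ({p | p.1 < p.2 ⟨f, hfe⟩} ∩ ({p | p.2 ⟨f, hfe⟩ = ∞}ᶜ ∩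
        ⋂ g : ({e}ᶜ : Set Edge), ⋂ (_ : (g : Edge) ∈ star f), ⋂ (_ : (g : Edge) ≠ f),
          {p | p.2 ⟨f, hfe⟩ < p.2 g}))
  have hsnd (g : ({e}ᶜ : Set Edge)) :
      Measurable fun p : ℝ≥0∞ × (({e}ᶜ : Set Edge) → ℝ≥0∞) => p.2 g :=
    (measurable_pi_apply g).comp measurable_snd
  have hC : MeasurableSet C := by
    refine MeasurableSet.inter ?_ (MeasurableSet.inter ?_ (MeasurableSet.inter ?_ ?_))
    · exact MeasurableSet.iInter fun g => MeasurableSet.iInter fun _ =>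
        measurableSet_lt measurable_fst (hsnd g)
    · exact measurableSet_lt measurable_fst (hsnd _)
    · exact (measurableSet_eq_fun (hsnd _) measurable_const).compl
    · exact MeasurableSet.iInter fun g => MeasurableSet.iInter fun _ => MeasurableSet.iInter fun _ =>
        measurableSet_lt (hsnd _) (hsnd g)
  have hCmem (t : ℝ≥0∞) (ω : Ω) : (t, fun g : ({e}ᶜ : Set Edge) => T g ω) ∈ C ↔
      (∀ g ∈ D, t < T g ω) ∧ t < T f ω ∧ FirstRing (star f) f fun g => T g ω := by
    simp only [C, FirstRing, Set.mem_inter_iff, Set.mem_compl_iff, Set.mem_ofPred_eq,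
      Set.mem_iInter]
    exact and_congr ⟨fun h g hg => h ⟨g, hg.2⟩ hg, fun h g hg => h g hg⟩ (and_congr_right fun _ =>
      and_congr_right fun _ => ⟨fun h g hg hgf => h ⟨g, hne hg⟩ hg hgf,
        fun h g hg hgf => h g hg hgf⟩)
  have hDB : Disjoint D (star f) := Set.disjoint_left.2 fun g hg => hg.1.2
  have hCt (t : ℝ≥0) : P {ω | ((t : ℝ≥0∞), fun g : ({e}ᶜ : Set Edge) => T g ω) ∈ C} =
      ENNReal.ofReal (μ.real {f} / μ.real (star f) *
        Real.exp (-((μ.real D + μ.real (star f)) * t))) := by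
    have hind := indepFun_restrict_of_disjoint hT.measurable hT.indep hDB
    let f' : star f := ⟨f, touch_self f⟩
    have hms : MeasurableSet {x : D → ℝ≥0∞ | ∀ g, t < x g} := by
      rw [Set.ofPred_forall]
      exact MeasurableSet.iInter fun g => measurableSet_lt measurable_const (measurable_pi_apply g)
    have hms' : MeasurableSet {x : star f → ℝ≥0∞ | t < x f' ∧ x f' ≠ ∞ ∧ ∀ g, g ≠ f' →
        x f' < x g} := by
      refine MeasurableSet.inter (measurableSet_lt measurable_const (measurable_pi_apply _))
        (MeasurableSet.inter
          (measurableSet_eq_fun (measurable_pi_apply _) measurable_const).compl ?_)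
      have hall : {x : star f → ℝ≥0∞ | ∀ g, g ≠ f' → x f' < x g} =
          ⋂ g, ⋂ (_ : g ≠ f'), {x | x f' < x g} := by
        ext x; simp
      refine (congrArg MeasurableSet hall).mpr ?_
      exact MeasurableSet.iInter fun g => MeasurableSet.iInter fun _ =>
        measurableSet_lt (measurable_pi_apply _) (measurable_pi_apply _)
    have hm := hind.measure_inter_preimage_eq_mul _ _ hms hms'
    have e1 : (fun ω (g : D) => T g ω) ⁻¹' {x : D → ℝ≥0∞ | ∀ g, t < x g} =
        {ω | ∀ g ∈ D, t < T g ω} := by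
      ext ω; simp
    have e2 : (fun ω (g : star f) => T g ω) ⁻¹' {x : star f → ℝ≥0∞ | t < x f' ∧ x f' ≠ ∞ ∧
        ∀ g, g ≠ f' → x f' < x g} = {ω | t < T f ω ∧ FirstRing (star f) f fun g => T g ω} := by
      ext ω
      simp only [Set.mem_preimage, Set.mem_ofPred_eq, FirstRing, f']
      refine and_congr_right fun _ => and_congr_right fun _ =>
        ⟨fun h g hg hgf => h ⟨g, hg⟩ fun h' => hgf (congrArg Subtype.val h'),
          fun h g hg => h g g.2 fun h' => hg (Subtype.ext h')⟩
    rw [e1, e2, hT.measure_forall_lt, hT.measure_lt_firstRing (touch_self f) hf,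
      ← ENNReal.ofReal_mul (Real.exp_pos _).le] at hm
    have e3 : {ω | ((t : ℝ≥0∞), fun g : ({e}ᶜ : Set Edge) => T g ω) ∈ C} =
        {ω | ∀ g ∈ D, t < T g ω} ∩ {ω | t < T f ω ∧ FirstRing (star f) f fun g => T g ω} := by
      ext ω; exact hCmem _ ω
    rw [e3, hm]
    congr 1
    rw [add_mul, neg_add, Real.exp_add]
    ring
  have hrace := measure_race (hT.measurable e) (hT.measurable_compl e)
    (hT.indepFun_compl e) (ENNReal.toReal_pos he (measure_ne_top _ _))
    (add_nonneg measureReal_nonneg measureReal_nonneg)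
    (div_nonneg measureReal_nonneg measureReal_nonneg) (hT.tail e) hC hCt 0
  have hU : μ.real {e} + (μ.real D + μ.real (star f)) = μ.real (star e ∪ star f) := by
    have h1 : star e ∪ star f = {e} ∪ (D ∪ star f) := by
      ext g
      simp only [D, Set.mem_union, Set.mem_sdiff, Set.mem_singleton_iff]
      have : g = e → g ∈ star e := fun h => h ▸ touch_self e
      tauto
    have h2 : Disjoint {e} (D ∪ star f) := by
      rw [Set.disjoint_singleton_left]
      rintro (h | h)
      · exact h.2 rfl
      · exact hne h rfl
    rw [h1, measureReal_union h2 MeasurableSet.of_discrete,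
      measureReal_union hDB MeasurableSet.of_discrete]
  have hUpos : 0 < μ (star e ∪ star f) := (pos_iff_ne_zero.2 he).trans_le
    ((mass_le_star e).trans (measure_mono Set.subset_union_left))
  have hBpos : 0 < μ (star f) := (pos_iff_ne_zero.2 hf).trans_le (mass_le_star f)
  calc _ ≤ P {ω | ((0 : ℝ≥0) : ℝ≥0∞) < T e ω ∧
          (T e ω, fun g : ({e}ᶜ : Set Edge) => T g ω) ∈ C} := by
        refine measure_mono_ae ?_
        filter_upwards [hT.ae_pos] with ω hω h
        exact ⟨hω e, (hCmem _ ω).2 ⟨fun g hg => h.2.1.2 g hg.1.1 hg.2, h.1, h.2.2⟩⟩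
    _ = _ := by
        rw [hrace]
        change ENNReal.ofReal (μ.real {e} / (μ.real {e} + _) * _ *
          Real.exp (-((μ.real {e} + _) * _))) = _
        rw [hU, NNReal.coe_zero, mul_zero, neg_zero, Real.exp_zero, mul_one,
          ENNReal.ofReal_mul (by positivity)]
        simp only [Measure.real, seedWeight]
        rw [ENNReal.ofReal_div_of_pos (ENNReal.toReal_pos hUpos.ne' (measure_ne_top _ _)),
          ENNReal.ofReal_div_of_pos (ENNReal.toReal_pos hBpos.ne' (measure_ne_top _ _))]
        simp only [ENNReal.ofReal_toReal (measure_ne_top _ _)]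

lemma measure_firstRing_inter_le (hT : IsExponentialClocks T μ P) {e f : Edge}
    (ht : ¬ Touch e f) (he : μ {e} ≠ 0) (hf : μ {f} ≠ 0) :
    P ({ω | FirstRing (star e) e fun g => T g ω} ∩ {ω | FirstRing (star f) f fun g => T g ω}) ≤
      μ {e} / μ (star e ∪ star f) * seedWeight μ f +
        μ {f} / μ (star e ∪ star f) * seedWeight μ e := by
  have h2 := hT.measure_firstRing_pair_le (fun h => ht h.symm) hf he
  rw [Set.union_comm] at h2
  refine le_trans (measure_mono_ae ?_) ((measure_union_le _ _).trans
    (add_le_add (hT.measure_firstRing_pair_le ht he hf) h2))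
  filter_upwards [hT.ae_ne] with ω hω h
  have hef : e ≠ f := fun h => ht (h ▸ touch_self e)
  rcases (hω e f hef h.1.1).lt_or_gt with hlt | hlt
  · exact Or.inl ⟨hlt, h.1, h.2⟩
  · exact Or.inr ⟨hlt, h.2, h.1⟩

/-- Borel–Cantelli: by `1 - exp (-x) ≤ x`, the probabilities of ringing by time `n` sum to at most
`n`. -/
lemma ae_finite (hT : IsExponentialClocks T μ P) :
    ∀ᵐ ω ∂P, ∀ t : ℝ≥0, {e | T e ω ≤ t}.Finite := by
  have h1 : ∀ᵐ ω ∂P, ∀ n : ℕ, {e | T e ω ≤ (n : ℝ≥0)}.Finite := by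
    rw [ae_all_iff]
    intro n
    refine ae_finite_setOfPred_mem (s := fun e => {ω | T e ω ≤ (n : ℝ≥0)}) (ne_top_of_le_ne_top
      (b := ∑' e, μ {e} * n) ?_ (ENNReal.tsum_le_tsum fun e => ?_))
    · have := Measure.tsum_indicator_apply_singleton μ Set.univ MeasurableSet.univ
      simp only [Set.indicator_univ] at this
      rw [ENNReal.tsum_mul_right, this, measure_univ, one_mul]
      exact ENNReal.natCast_ne_top n
    · have hc : {ω | T e ω ≤ (n : ℝ≥0)} = {ω | (n : ℝ≥0) < T e ω}ᶜ := by
        ext ω; simp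
      rw [hc, prob_compl_eq_one_sub (measurableSet_lt measurable_const (hT.measurable e)),
        hT.tail, ← ENNReal.ofReal_one, ← ENNReal.ofReal_sub _ (Real.exp_pos _).le]
      have h2 : (1 : ℝ) - Real.exp (-(μ.real {e} * (n : ℝ≥0))) ≤ μ.real {e} * n := by
        have := Real.add_one_le_exp (-(μ.real {e} * (n : ℝ≥0)))
        simp only [NNReal.coe_natCast] at this ⊢
        linarith
      refine (ENNReal.ofReal_le_ofReal h2).trans ?_
      rw [ENNReal.ofReal_mul measureReal_nonneg, ENNReal.ofReal_natCast, Measure.real,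
        ENNReal.ofReal_toReal (measure_ne_top _ _)]
  filter_upwards [h1] with ω hω t
  obtain ⟨n, hn⟩ := exists_nat_ge t
  exact (hω n).subset fun e (he : T e ω ≤ t) => he.trans (ENNReal.coe_le_coe.2 hn)

lemma ae_mem_iff (hT : IsExponentialClocks T μ P) :
    ∀ᵐ ω ∂P, ∀ e, e ∈ {e | 0 < μ {e}} ↔ ∃ t : ℝ≥0, e ∈ {e | T e ω ≤ t} := by
  rw [ae_all_iff]
  intro e
  by_cases he : μ {e} = 0
  · filter_upwards [hT.ae_top he] with ω hω
    simp [he, hω]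
  · filter_upwards [hT.ae_ne_top he] with ω hω
    exact iff_of_true (pos_iff_ne_zero.2 he) ⟨(T e ω).toNNReal, (ENNReal.coe_toNNReal hω).ge⟩

end IsExponentialClocks

lemma FirstRing.isSeed {e : Edge} {T : Edge → ℝ≥0∞} (h : FirstRing (star e) e T) :
    IsSeed (fun t : ℝ≥0 => {e | T e ≤ t}) e := by
  refine ⟨(T e).toNNReal, (ENNReal.coe_toNNReal h.1).ge, fun f hf hfe ht => ?_⟩
  have hf : T f ≤ (T e).toNNReal := hf
  rw [ENNReal.coe_toNNReal h.1] at hf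
  exact hf.not_gt (h.2 f ht hfe)

lemma exists_joined_firstRing {T : Edge → ℝ≥0∞} (hne : ∀ e f, e ≠ f → T e ≠ ∞ → T e ≠ T f)
    {t : ℝ≥0} (hfin : {e | T e ≤ t}.Finite) :
    ∀ e ∈ {e | T e ≤ t}, ∀ u ∈ (e : Sym2 ℕ),
      ∃ r ∈ {e | T e ≤ t} ∩ {e | FirstRing (star e) e T}, ∃ v ∈ (r : Sym2 ℕ),
        Joined {e | T e ≤ t} u v := by
  refine exists_joined_of_rank T hfin fun e (he : T e ≤ t) => ?_
  have htop : T e ≠ ∞ := ne_top_of_le_ne_top ENNReal.coe_ne_top he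
  by_cases h : ∀ f ∈ star e, f ≠ e → T e < T f
  · exact Or.inl ⟨htop, h⟩
  · push Not at h
    obtain ⟨f, hf, hfe, hle⟩ := h
    -- The absence of ties makes the rank drop strictly.
    exact Or.inr ⟨f, hle.trans he, hf, hle.lt_of_ne (hne e f hfe.symm htop).symm⟩

/-! ### From Poisson processes to clocks, and the theorem -/

lemma IsPoissonEdgeProcess.ae_lt_arrival_iff {μ : Measure Edge} {Ω : Type*} [MeasurableSpace Ω]
    {P : Measure Ω} {N : Edge → ℝ≥0 → Ω → ℕ} (hN : IsPoissonEdgeProcess N μ P) :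
    ∀ᵐ ω ∂P, ∀ e, ∀ t : ℝ≥0, t < arrival (fun t => N e t ω) ↔ N e t ω = 0 := by
  rw [ae_all_iff]
  intro e
  filter_upwards [(hN.poisson e).path_monotone, (hN.poisson e).path_rightContinuous] with ω h1 h2
  exact lt_arrival_iff h1 h2

section

variable {μ : Measure Edge} {Ω : Type*} [MeasurableSpace Ω] {P : Measure Ω}
  {N : Edge → ℝ≥0 → Ω → ℕ}

/-- The graph depends only on first arrivals, and the exponential tail is the Poisson mass at `0`.
-/
lemma IsPoissonEdgeProcess.isExponentialClocks (hN : IsPoissonEdgeProcess N μ P) :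
    IsExponentialClocks (fun e ω => arrival fun t => N e t ω) μ P where
  measurable e := measurable_arrival.comp (measurable_pi_lambda _ (hN.poisson e).measurable)
  indep := hN.indep.comp (fun _ => arrival) fun _ => measurable_arrival
  tail e t := by
    have h1 : {ω | t < arrival fun t => N e t ω} =ᵐ[P]
        (fun ω => N e t ω - N e 0 ω) ⁻¹' {0} := by
      filter_upwards [hN.ae_lt_arrival_iff, (hN.poisson e).start] with ω hω h0
      refine propext ((hω e t).trans ?_)
      change _ ↔ N e t ω - N e 0 ω = 0
      rw [h0, Nat.sub_zero]
    have hlaw := (hN.poisson e).increment_law 0 t zero_le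
    rw [measure_congr h1, ← Measure.map_apply_of_aemeasurable hlaw.aemeasurable
      MeasurableSet.of_discrete, hlaw.map_eq, poissonMeasure_singleton]
    simp [Measure.real, ENNReal.coe_toNNReal_eq_toReal]

lemma IsPoissonEdgeProcess.ae_continuousGraph_eq (hN : IsPoissonEdgeProcess N μ P) :
    ∀ᵐ ω ∂P, (continuousGraph fun e t => N e t ω) =
      fun t : ℝ≥0 => edgeGraph {e | arrival (fun t => N e t ω) ≤ t} := by
  filter_upwards [hN.ae_lt_arrival_iff] with ω hω
  funext t
  refine congrArg edgeGraph (Set.ext fun e => ?_)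
  change 0 < N e t ω ↔ arrival (fun t => N e t ω) ≤ t
  rw [← not_lt, hω e t, Nat.pos_iff_ne_zero]

lemma ringing_mono (T : Edge → ℝ≥0∞) : Monotone fun t : ℝ≥0 => {e | T e ≤ t} :=
  fun _ _ hst _ he => le_trans he (ENNReal.coe_le_coe.2 hst)

variable [IsProbabilityMeasure μ] [IsProbabilityMeasure P]

theorem IsPoissonEdgeProcess.ae_connected (hN : IsPoissonEdgeProcess N μ P)
    (hconn : (supportGraph μ).Connected) (hsum : ∑' e, seedWeight μ e ≠ ∞) :
    ∀ᵐ ω ∂P, EventuallyForever SimpleGraph.Subgraph.Connected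
      (continuousGraph fun e t => N e t ω) := by
  have hT := hN.isExponentialClocks
  filter_upwards [hN.ae_continuousGraph_eq, hT.ae_mem_iff, hT.ae_finite, hT.ae_ne,
    ae_finite_seeds (fun e => hT.measure_firstRing (touch_self e)) hsum] with ω hG hω hfin hne hR
  rw [hG]
  exact eventuallyForever_connected (ringing_mono _) hω hconn hR
    fun t => exists_joined_firstRing hne (hfin t)

theorem IsPoissonEdgeProcess.ae_not_connected (hN : IsPoissonEdgeProcess N μ P)
    (h : ¬ (supportGraph μ).Connected ∨ ∑' e, seedWeight μ e = ∞) :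
    ∀ᵐ ω ∂P, ¬ EventuallyForever SimpleGraph.Subgraph.Connected
      (continuousGraph fun e t => N e t ω) := by
  have hT := hN.isExponentialClocks
  rcases h with h | h
  · filter_upwards [hN.ae_continuousGraph_eq, hT.ae_mem_iff] with ω hG hω
    rw [hG]
    exact not_eventuallyForever_of_not_connected (ringing_mono _) hω support_nonempty h
  · filter_upwards [hN.ae_continuousGraph_eq, hT.ae_finite,
      ae_infinite_seeds (fun e => hT.measurableSet_firstRing (star e) e)
        (fun e => hT.measure_firstRing (touch_self e))
        (fun e f hef ht => measure_mono_null (fun ω hω => lt_asymm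
          (hω.1.2 f ht hef.symm) (hω.2.2 e ht.symm hef)) measure_empty)
        (fun e f ht he hf => hT.measure_firstRing_inter_le ht he hf) h] with ω hG hfin hω
    rw [hG]
    exact not_eventuallyForever_of_infinite_seeds (ringing_mono _) hfin
      (hω.mono fun e he => FirstRing.isSeed he)

end

end EdgeExchangeable

theorem theorem4p1
    (μ : Measure Edge) [IsProbabilityMeasure μ]
    {Ω : Type*} [MeasurableSpace Ω] (P : Measure Ω)
    [IsProbabilityMeasure P]
    (N : Edge → ℝ≥0 → Ω → ℕ)
    (hN : IsPoissonEdgeProcess N μ P)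
    {Ω' : Type*} [MeasurableSpace Ω'] (P' : Measure Ω')
    [IsProbabilityMeasure P']
    (ξ : ℕ → Ω' → Edge)
    (hξ : IsIIDSample ξ μ P') :
    (((supportGraph μ).Connected ∧
        ∑' e : Edge, μ {e} / edgeMass μ e < ∞) →
      (∀ᵐ ω ∂P, EventuallyForever SimpleGraph.Subgraph.Connected
        (continuousGraph fun e t => N e t ω)) ∧
      (∀ᵐ ω ∂P', EventuallyForever SimpleGraph.Subgraph.Connected
        (discreteGraph fun n => ξ n ω))) ∧
    (¬ ((supportGraph μ).Connected ∧
        ∑' e : Edge, μ {e} / edgeMass μ e < ∞) →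
      (∀ᵐ ω ∂P, ¬ EventuallyForever SimpleGraph.Subgraph.Connected
        (continuousGraph fun e t => N e t ω)) ∧
      (∀ᵐ ω ∂P', ¬ EventuallyForever SimpleGraph.Subgraph.Connected
        (discreteGraph fun n => ξ n ω))) := by
  have hw : ∑' e : Edge, μ {e} / edgeMass μ e = ∑' e, seedWeight μ e :=
    tsum_congr fun e => by rw [edgeMass_eq, seedWeight]
  rw [hw]
  refine ⟨fun h => ⟨hN.ae_connected h.1 h.2.ne, hξ.ae_connected h.1 h.2.ne⟩, fun h => ?_⟩
  have h' : ¬ (supportGraph μ).Connected ∨ ∑' e, seedWeight μ e = ∞ := by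
    rwa [not_and_or, not_lt_top_iff] at h
  exact ⟨hN.ae_not_connected h', hξ.ae_not_connected h'⟩
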